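/- For $t\ge 0$ let $P_t$ be the path on $t$ vertices; a finite simple graph is $P_t$-free if it has no induced subgraph isomorphic to $P_t$. Given a graph $G$ with nonnegative real vertex weights $w$, Maximum-Weight Independent Set asks for an independent set $S$ of $G$ maximizing $w(S)=\sum_{v\in S}w(v)$; with $w\equiv 1$ it is Maximum Independent Set (MIS). The running time is the number of steps of a deterministic random access machine with unit-cost addition, truncated subtraction, comparison, and indirect memory access on natural numbers, and unit-cost copying, addition and comparison (and no other operation) on weights. There are a single algorithm and a constant $C$ such that, for all integers $t,n\ge 0$, given $t$, the adjacency matrix of any $n$-vertex $P_t$-free graph $G$, and any vertex weights $w\colon V(G)\to\mathbb{R}_{\ge 0}$, the algorithm outputs a maximum-weight independent set of $G$ together with its weight after at most $$C\cdot 2^{\,C\sqrt{t\,n\log n}}$$ steps (where $n\log n$ is read as $0$ for $n=0$). That is, Maximum-Weight Independent Set on $n$-vertex $P_t$-free graphs can be solved in time $2^{O(\sqrt{tn\log n})}$, where the hidden constant does not depend on $t$, $n$, $G$ or $w$. In particular, for every fixed $t\ge 5$ there are an algorithm and a constant $C$ (which may depend on $t$) such that the algorithm solves MIS on every $n$-vertex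 $P_t$-free graph after at most $C\cdot 2^{\,C\sqrt{n\log n}}$ steps. -/

import Mathlib

open scoped NNReal

/-! A deterministic random access machine in structured form. Besides natural numbers it handles
vertex weights, which are nonnegative reals that can only be copied, added and compared. -/

namespace RAM

/-- Contents of the machine: number registers, number arrays (array name, then cell), weight
registers and weight arrays. The registers and the arrays named by a program are fixed by its text,
so there are finitely many of them; cells of an array are addressed by the content of a register. -/
structure State where
  reg : ℕ → ℕ
  arr : ℕ → ℕ → ℕ
  wreg : ℕ → ℝ≥0
  warr : ℕ → ℕ → ℝ≥0

/-- Elementary instructions. There is no multiplication, and no conversion between numbers and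
weights. -/
inductive Instr where
  /-- `reg x := c` -/
  | const (x c : ℕ)
  /-- `reg x := reg y` -/
  | move (x y : ℕ)
  /-- `reg x := reg y + reg z` -/
  | add (x y z : ℕ)
  /-- `reg x := reg y - reg z` (truncated at zero) -/
  | sub (x y z : ℕ)
  /-- `reg x := arr a (reg y)` -/
  | load (x a y : ℕ)
  /-- `arr a (reg x) := reg y` -/
  | store (a x y : ℕ)
  /-- `wreg u := 0` -/
  | wzero (u : ℕ)
  /-- `wreg u := wreg v` -/
  | wmove (u v : ℕ)
  /-- `wreg u := wreg v + wreg v'` -/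
  | wadd (u v v' : ℕ)
  /-- `wreg u := warr a (reg y)` -/
  | wload (u a y : ℕ)
  /-- `warr a (reg x) := wreg u` -/
  | wstore (a x u : ℕ)

/-- The effect of an elementary instruction. -/
def Instr.apply : Instr → State → State
  | .const x c, s => { s with reg := Function.update s.reg x c }
  | .move x y, s => { s with reg := Function.update s.reg x (s.reg y) }
  | .add x y z, s => { s with reg := Function.update s.reg x (s.reg y + s.reg z) }
  | .sub x y z, s => { s with reg := Function.update s.reg x (s.reg y - s.reg z) }
  | .load x a y, s => { s with reg := Function.update s.reg x (s.arr a (s.reg y)) }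
  | .store a x y, s =>
      { s with arr := Function.update s.arr a (Function.update (s.arr a) (s.reg x) (s.reg y)) }
  | .wzero u, s => { s with wreg := Function.update s.wreg u 0 }
  | .wmove u v, s => { s with wreg := Function.update s.wreg u (s.wreg v) }
  | .wadd u v v', s => { s with wreg := Function.update s.wreg u (s.wreg v + s.wreg v') }
  | .wload u a y, s => { s with wreg := Function.update s.wreg u (s.warr a (s.reg y)) }
  | .wstore a x u, s =>
      { s with warr := Function.update s.warr a (Function.update (s.warr a) (s.reg x) (s.wreg u)) }

/-- Tests on the contents of two registers. -/
inductive Test where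
  | lt (x y : ℕ)
  | le (x y : ℕ)
  | eq (x y : ℕ)
  | ne (x y : ℕ)
  | wlt (u v : ℕ)
  | wle (u v : ℕ)

/-- The outcome of a test. -/
def Test.Holds : Test → State → Prop
  | .lt x y, s => s.reg x < s.reg y
  | .le x y, s => s.reg x ≤ s.reg y
  | .eq x y, s => s.reg x = s.reg y
  | .ne x y, s => s.reg x ≠ s.reg y
  | .wlt u v, s => s.wreg u < s.wreg v
  | .wle u v, s => s.wreg u ≤ s.wreg v

/-- Commands: `branch b p q` is "if `b` then `p` else `q`", `loop b p` is "while `b` do `p`", and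
`call k` executes the `k`-th procedure of the program. -/
inductive Cmd where
  | skip
  | instr (i : Instr)
  | seq (p q : Cmd)
  | branch (b : Test) (p q : Cmd)
  | loop (b : Test) (p : Cmd)
  | call (k : ℕ)

/-- A program: a main command and finitely many (possibly mutually recursive) parameterless
procedures. All registers and arrays are global. -/
structure Program where
  main : Cmd
  procs : List Cmd

/-- `Exec ps p s T s'`: with procedures `ps`, the command `p` started in the state `s` halts in the
state `s'` after exactly `T` steps. Every instruction, every evaluation of a test and every
procedure call is one step. -/
inductive Exec (ps : List Cmd) : Cmd → State → ℕ → State → Prop where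
  | skip (s : State) : Exec ps .skip s 1 s
  | instr (i : Instr) (s : State) : Exec ps (.instr i) s 1 (i.apply s)
  | seq {p q : Cmd} {s s' s'' : State} {T T' : ℕ} :
      Exec ps p s T s' → Exec ps q s' T' s'' → Exec ps (.seq p q) s (T + T') s''
  | branch_true {b : Test} {p q : Cmd} {s s' : State} {T : ℕ} :
      b.Holds s → Exec ps p s T s' → Exec ps (.branch b p q) s (T + 1) s'
  | branch_false {b : Test} {p q : Cmd} {s s' : State} {T : ℕ} :
      ¬ b.Holds s → Exec ps q s T s' → Exec ps (.branch b p q) s (T + 1) s'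
  | loop_true {b : Test} {p : Cmd} {s s' s'' : State} {T T' : ℕ} :
      b.Holds s → Exec ps p s T s' → Exec ps (.loop b p) s' T' s'' →
      Exec ps (.loop b p) s (T + T' + 1) s''
  | loop_false {b : Test} {p : Cmd} {s : State} :
      ¬ b.Holds s → Exec ps (.loop b p) s 1 s
  | call {k : ℕ} {p : Cmd} {s s' : State} {T : ℕ} :
      ps[k]? = some p → Exec ps p s T s' → Exec ps (.call k) s (T + 1) s'

end RAM

/-- `S` is an independent set of `G` of maximum weight with respect to `w`. -/
def IsMaxWeightIndepSet {n : ℕ} (G : SimpleGraph (Fin n)) (w : Fin n → ℝ≥0)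
    (S : Finset (Fin n)) : Prop :=
  G.IsIndepSet (S : Set (Fin n)) ∧
    ∀ S' : Finset (Fin n), G.IsIndepSet (S' : Set (Fin n)) → ∑ v ∈ S', w v ≤ ∑ v ∈ S, w v

/-- `G` is `P_t`-free: it has no induced path on `t` vertices. -/
def IsPathFree (t : ℕ) {n : ℕ} (G : SimpleGraph (Fin n)) : Prop :=
  ¬ (SimpleGraph.pathGraph t).IsIndContained G

open Classical in
/-- The input `(t, G, w)`: register `0` holds the number `n` of vertices, register `1` holds `t`,
number array `0` holds the adjacency matrix of `G` row by row, weight array `0` holds the weights.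
Everything else is zero. -/
noncomputable def inputState (t : ℕ) {n : ℕ} (G : SimpleGraph (Fin n)) (w : Fin n → ℝ≥0) :
    RAM.State where
  reg x := if x = 0 then n else if x = 1 then t else 0
  arr a c := if a = 0 ∧ ∃ i j : Fin n, G.Adj i j ∧ c = n * (i : ℕ) + (j : ℕ) then 1 else 0
  wreg _ := 0
  warr a c := if h : a = 0 ∧ c < n then w ⟨c, h.2⟩ else 0

/-- The final state `s` presents the vertex set `S` and its weight: cells `0, …, n - 1` of number
array `1` are the indicator function of `S`, and weight register `0` is the weight of `S`. -/
def IsOutput {n : ℕ} (w : Fin n → ℝ≥0) (S : Finset (Fin n)) (s : RAM.State) : Prop :=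
  (∀ v : Fin n, s.arr 1 (v : ℕ) = if v ∈ S then 1 else 0) ∧ s.wreg 0 = ∑ v ∈ S, w v

/-- On the input `(t, G, w)` the program halts after at most `B` steps and outputs a maximum weight
independent set of `G` together with its weight. -/
def SolvesWithin (P : RAM.Program) (t : ℕ) {n : ℕ} (G : SimpleGraph (Fin n)) (w : Fin n → ℝ≥0)
    (B : ℝ) : Prop :=
  ∃ (T : ℕ) (s : RAM.State) (S : Finset (Fin n)),
    RAM.Exec P.procs P.main (inputState t G w) T s ∧ (T : ℝ) ≤ B ∧
    IsMaxWeightIndepSet G w S ∧ IsOutput w S s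

/-!
Fix a degree threshold `d`. If some vertex of the current graph has degree at least `d`, branch on
it: either it is discarded, or it is taken and more than `d` vertices disappear. This contributes a
factor of `2 ^ O(n log n / d)` to the size of the recursion tree. Once all degrees are below `d`,
grow an induced path in the manner of Gyárfás: components are solved one at a time, and in a
connected graph one branches on the frontier, the neighbours of the last vertex of the path. An
induced path has fewer than `t` vertices and each of them puts fewer than `d` vertices on the
frontier, which contributes a factor of `2 ^ O(t d)`. The two are balanced by
`d ≈ √(n log n / t)`.
-/

namespace PathFreeMWIS

open Finset RAM

/-! ### Labellings of induced subgraphs -/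

section Induced

variable {V : Type*} {G : SimpleGraph V} {A C D R : Finset V} {v x : V}

open Classical in
/-- The closed neighbourhood of `v` in the graph induced on `A`, for `v ∈ A`. -/
noncomputable def closedNhd (G : SimpleGraph V) (A : Finset V) (v : V) : Finset V :=
  {x ∈ A | x = v ∨ G.Adj v x}

open Classical in
/-- All degrees in the graph induced on `A` are less than `d`. -/
def DegreesBelow (G : SimpleGraph V) (d : ℕ) (A : Finset V) : Prop :=
  ∀ u ∈ A, #{x ∈ A | G.Adj u x} < d

/-- `C` is a nonempty union of components of the graph induced on `A`. -/
structure IsUnionOfComponents (G : SimpleGraph V) (A C : Finset V) : Prop where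
  subset : C ⊆ A
  nonempty : C.Nonempty
  closed : ∀ x ∈ C, ∀ y ∈ A, G.Adj x y → y ∈ C

/-- No nonempty proper subset of `A` is a union of components of the graph induced on `A`. -/
def IsConnectedOn (G : SimpleGraph V) (A : Finset V) : Prop :=
  ∀ C, IsUnionOfComponents G A C → C = A

@[simp] lemma mem_closedNhd : x ∈ closedNhd G A v ↔ x ∈ A ∧ (x = v ∨ G.Adj v x) := by
  classical exact mem_filter

lemma self_mem_closedNhd (hv : v ∈ A) : v ∈ closedNhd G A v := by simp [hv]

lemma closedNhd_subset : closedNhd G A v ⊆ A := fun _ h => (mem_closedNhd.1 h).1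

lemma DegreesBelow.mono {d : ℕ} (h : DegreesBelow G d A) (hCA : C ⊆ A) : DegreesBelow G d C := by
  classical
  exact fun u hu => (card_le_card (filter_subset_filter _ hCA)).trans_lt (h u (hCA hu))

open Classical in
lemma card_closedNhd (hv : v ∈ A) : #(closedNhd G A v) = #{x ∈ A | G.Adj v x} + 1 := by
  rw [← card_insert_of_notMem (a := v) (by simp)]
  congr 1
  grind [mem_closedNhd]

lemma isUnionOfComponents_self (h : A.Nonempty) : IsUnionOfComponents G A A :=
  ⟨Subset.rfl, h, fun _ _ _ hy _ => hy⟩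

lemma IsUnionOfComponents.trans (hC : IsUnionOfComponents G A C)
    (hD : IsUnionOfComponents G C D) : IsUnionOfComponents G A D :=
  ⟨hD.subset.trans hC.subset, hD.nonempty, fun x hx y hy hxy =>
    hD.closed x hx y (hC.closed x (hD.subset hx) y hy hxy) hxy⟩

lemma IsUnionOfComponents.sdiff [DecidableEq V] (hC : IsUnionOfComponents G A C) (hne : C ≠ A) :
    IsUnionOfComponents G A (A \ C) where
  subset := sdiff_subset
  nonempty := sdiff_nonempty.2 fun h => hne (hC.subset.antisymm h)
  closed x hx y hy hxy := by
    rw [mem_sdiff] at hx ⊢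
    exact ⟨hy, fun hyC => hx.2 (hC.closed y hyC x hx.1 hxy.symm)⟩

lemma IsUnionOfComponents.of_sdiff [DecidableEq V] (h : IsUnionOfComponents G (A \ R) C)
    (hR : ∀ r ∈ R, ∀ x ∈ C, ¬ G.Adj r x) : IsUnionOfComponents G A C where
  subset := h.subset.trans sdiff_subset
  nonempty := h.nonempty
  closed x hx y hy hxy :=
    h.closed x hx y (mem_sdiff.2 ⟨hy, fun hyR => hR y hyR x hx hxy.symm⟩) hxy

end Induced

section Labelling

variable {V : Type*} {G : SimpleGraph V} {lab : V → ℕ} {R : Finset V} {m : ℕ} {x z : V}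

/-- The vertices that are still in play. In a labelling `lab`, the label `0` means discarded, `1`
removed but remembered as the end of an induced path, `2` active, and `3` active and next in line
for branching. -/
def active [Fintype V] (lab : V → ℕ) : Finset V := {x | 2 ≤ lab x}

/-- The frontier: the active vertices that are next in line for branching. -/
def pending [Fintype V] (lab : V → ℕ) : Finset V := {x | lab x = 3}

/-- The active vertices outside the frontier. -/
def core [Fintype V] (lab : V → ℕ) : Finset V := {x | 2 ≤ lab x ∧ lab x ≠ 3}

/-- The labelling in which the vertices of `R` have got the label `m`. -/
def relabel [DecidableEq V] (lab : V → ℕ) (R : Finset V) (m : ℕ) : V → ℕ :=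
  fun x => if x ∈ R then m else lab x

open Classical in
/-- The labelling whose frontier is the active neighbourhood of `z`; the previously remembered
vertices are discarded. -/
noncomputable def advance (G : SimpleGraph V) (lab : V → ℕ) (z : V) : V → ℕ :=
  fun x => if 2 ≤ lab x then (if G.Adj z x then 3 else 2) else 0

lemma relabel_relabel [DecidableEq V] {R' : Finset V} {m' : ℕ} (h : R' ⊆ R) :
    relabel (relabel lab R' m') R m = relabel lab R m := by
  grind [relabel]

variable [Fintype V]

@[simp] lemma mem_active : x ∈ active lab ↔ 2 ≤ lab x := by simp [active]

@[simp] lemma mem_pending : x ∈ pending lab ↔ lab x = 3 := by simp [pending]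

@[simp] lemma mem_core : x ∈ core lab ↔ 2 ≤ lab x ∧ lab x ≠ 3 := by simp [core]

lemma active_advance : active (advance G lab z) = active lab := by
  grind [mem_active, advance]

open Classical in
lemma pending_advance : pending (advance G lab z) = {x ∈ active lab | G.Adj z x} := by
  grind [mem_active, mem_pending, advance]

lemma core_advance_subset (h : pending lab = ∅) : core (advance G lab z) ⊆ core lab := by
  intro x hx
  have : x ∉ pending lab := by simp [h]
  grind [mem_core, mem_pending, advance]

lemma not_adj_of_mem_core_advance (hx : x ∈ core (advance G lab z)) : ¬ G.Adj z x := by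
  grind [mem_core, advance]

variable [DecidableEq V]

lemma active_relabel (hm : m < 2) : active (relabel lab R m) = active lab \ R := by
  grind [mem_active, relabel]

lemma pending_relabel (hm : m < 2) : pending (relabel lab R m) = pending lab \ R := by
  grind [mem_pending, relabel]

lemma core_relabel (hm : m < 2) : core (relabel lab R m) = core lab \ R := by
  grind [mem_core, relabel]

end Labelling

section Branching

variable {V : Type*} [Fintype V] {G : SimpleGraph V} {d : ℕ} {lab lab' : V → ℕ} {R : Finset V}
  {m : ℕ} {v : V}

open Classical in
/-- `IsPivot G d lab lab' v m`: with degree threshold `d`, the algorithm may respond to the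
labelling `lab` by passing to `lab'` and branching on `v`, after which the vertices it removes get
the label `m`. -/
inductive IsPivot (G : SimpleGraph V) (d : ℕ) (lab : V → ℕ) : (V → ℕ) → V → ℕ → Prop
  | high {v : V} : v ∈ active lab → d ≤ #{x ∈ active lab | G.Adj v x} → IsPivot G d lab lab v 0
  | frontier {v : V} : DegreesBelow G d (active lab) → lab v = 3 → IsPivot G d lab lab v 1
  | extend {z v : V} : DegreesBelow G d (active lab) → pending lab = ∅ →
      IsConnectedOn G (active lab) → lab z = 1 → v ∈ active lab → G.Adj z v →
      IsPivot G d lab (advance G lab z) v 1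
  | start {v : V} : DegreesBelow G d (active lab) → pending lab = ∅ →
      IsConnectedOn G (active lab) → (∀ z, lab z = 1 → ∀ x ∈ active lab, ¬ G.Adj z x) →
      v ∈ active lab → IsPivot G d lab lab v 1

/-- The algorithm may respond to the labelling `lab` by treating `C` and the other active vertices
separately. -/
structure IsSplit (G : SimpleGraph V) (d : ℕ) (lab : V → ℕ) (C : Finset V) : Prop where
  degreesBelow : DegreesBelow G d (active lab)
  pending_eq : pending lab = ∅
  isUnion : IsUnionOfComponents G (active lab) C
  ne : C ≠ active lab

lemma IsPivot.active_eq (h : IsPivot G d lab lab' v m) : active lab' = active lab := by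
  cases h with
  | extend => exact active_advance
  | _ => rfl

lemma IsPivot.mem (h : IsPivot G d lab lab' v m) : v ∈ active lab := by
  cases h with
  | frontier _ h3 => simp [h3]
  | _ => assumption

lemma IsPivot.lt_two (h : IsPivot G d lab lab' v m) : m < 2 := by
  cases h <;> decide

variable [DecidableEq V]

/-- `RecTree G d lab c`: the branching algorithm with degree threshold `d`, started with the
labelling `lab`, may lead to a recursion tree with `c` nodes. -/
inductive RecTree (G : SimpleGraph V) (d : ℕ) : (V → ℕ) → ℕ → Prop
  | leaf {lab : V → ℕ} : active lab = ∅ → RecTree G d lab 1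
  | branch {lab lab' : V → ℕ} {v : V} {m c₁ c₂ : ℕ} : IsPivot G d lab lab' v m →
      RecTree G d (relabel lab' {v} m) c₁ →
      RecTree G d (relabel lab' (closedNhd G (active lab) v) m) c₂ →
      RecTree G d lab (c₁ + c₂ + 1)
  | split {lab : V → ℕ} {C : Finset V} {c₁ c₂ : ℕ} : IsSplit G d lab C →
      RecTree G d (relabel lab (active lab \ C) 0) c₁ → RecTree G d (relabel lab C 0) c₂ →
      RecTree G d lab (c₁ + c₂ + 1)

lemma IsPivot.active_relabel (h : IsPivot G d lab lab' v m) :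
    active (relabel lab' R m) = active lab \ R := by
  rw [PathFreeMWIS.active_relabel h.lt_two, h.active_eq]

end Branching

section Trail

variable {V : Type*} {G : SimpleGraph V} {X Y : Finset V} {k : ℕ} {r y : V}

/-- `IsTrail G X k r`: there is an induced path of `G` with `k` edges that ends in `r`, avoids `X`,
and all of whose vertices other than `r` have no neighbour in `X`. The path is traversed from `r`
backwards. -/
def IsTrail (G : SimpleGraph V) (X : Finset V) (k : ℕ) (r : V) : Prop :=
  ∃ f : SimpleGraph.pathGraph (k + 1) ↪g G,
    f 0 = r ∧ (∀ i, f i ∉ X) ∧ ∀ i : Fin k, ∀ x ∈ X, ¬ G.Adj (f i.succ) x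

lemma isTrail_zero (h : r ∉ X) : IsTrail G X 0 r :=
  ⟨⟨⟨fun _ => r, fun _ _ _ => Subsingleton.elim (α := Fin 1) _ _⟩, by simp [Fin.forall_fin_one]⟩,
    rfl, fun _ => h, fun i => i.elim0⟩

lemma IsTrail.mono (h : IsTrail G X k r) (hY : Y ⊆ X) : IsTrail G Y k r :=
  let ⟨f, h0, hX, hadj⟩ := h
  ⟨f, h0, fun i hi => hX i (hY hi), fun i x hx => hadj i x (hY hx)⟩

lemma IsTrail.extend (h : IsTrail G X k r) (hYX : Y ⊆ X) (hy : y ∈ X) (hry : G.Adj r y)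
    (hY : ∀ x ∈ Y, ¬ G.Adj r x) : IsTrail G Y (k + 1) y := by
  obtain ⟨f, rfl, hX, hadj⟩ := h
  have adj_iff : ∀ j, G.Adj y (f j) ↔ (j : ℕ) = 0 := Fin.cases (by simpa using hry.symm)
    fun j => by simpa [G.adj_comm y] using hadj j y hy
  refine ⟨⟨⟨Fin.cons y f, Fin.cons_injective_iff.2 ⟨?_, f.injective⟩⟩, fun {i j} => ?_⟩,
    rfl, Fin.cases (fun h => hY y h hry) fun i hi => hX i (hYX hi), Fin.cases ?_ fun i x hx => ?_⟩
  · rintro ⟨i, hi⟩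
    exact hX i (hi ▸ hy)
  · cases i using Fin.cases <;> cases j using Fin.cases
    · simp
    · simp [adj_iff, SimpleGraph.pathGraph_adj, eq_comm]
    · simp [adj_iff, SimpleGraph.pathGraph_adj, eq_comm, G.adj_comm _ y]
    · simp [SimpleGraph.pathGraph_adj]
  · exact hY
  · exact hadj i x (hYX hx)

lemma IsTrail.lt_card [Fintype V] (h : IsTrail G X k r) : k < Fintype.card V := by
  obtain ⟨f, -⟩ := h
  simpa using Fintype.card_le_of_injective f f.injective

lemma IsTrail.lt_of_isPathFree {n t : ℕ} {G : SimpleGraph (Fin n)} {X : Finset (Fin n)}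
    {r : Fin n} (h : IsTrail G X k r) (ht : IsPathFree t G) : k < t := by
  obtain ⟨f, -⟩ := h
  by_contra! hk
  refine ht ⟨(⟨Fin.castLEEmb (by omega), ?_⟩ : SimpleGraph.pathGraph t ↪g _).trans f⟩
  simp [SimpleGraph.pathGraph_adj]

end Trail

/-! ### The size of the recursion tree -/

section TrailInvariant

variable {V : Type*} [Fintype V] {G : SimpleGraph V} {A₀ R : Finset V} {lab : V → ℕ} {k : ℕ}
  {v z : V}

/-- The invariant of the branching along an induced path inside `A₀`: the remembered vertices and
the frontier end induced paths with at least `k` edges whose earlier vertices have no neighbour in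
the core, and each component of the active vertices meets the frontier or is adjacent to a
remembered vertex. -/
structure TrailInvariant (G : SimpleGraph V) (A₀ : Finset V) (k : ℕ) (lab : V → ℕ) : Prop where
  mem : ∀ x, 1 ≤ lab x → x ∈ A₀
  trail : ∀ r, lab r = 1 ∨ lab r = 3 → ∃ k' ≥ k, IsTrail G (core lab) k' r
  link : ∀ C, IsUnionOfComponents G (active lab) C →
    (∃ x ∈ C, lab x = 3) ∨ ∃ r, lab r = 1 ∧ ∃ x ∈ C, G.Adj r x

lemma TrailInvariant.active_subset (h : TrailInvariant G A₀ k lab) : active lab ⊆ A₀ :=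
  fun x hx => h.mem x (one_le_two.trans (mem_active.1 hx))

lemma TrailInvariant.advance (h : TrailInvariant G A₀ k lab) (hp : pending lab = ∅)
    (hconn : IsConnectedOn G (active lab)) (hz : lab z = 1) (hv : v ∈ active lab)
    (hzv : G.Adj z v) : TrailInvariant G A₀ (k + 1) (advance G lab z) where
  mem x hx := h.mem x (by grind [PathFreeMWIS.advance])
  trail r hr := by
    obtain ⟨hr2, hzr⟩ : 2 ≤ lab r ∧ G.Adj z r := by grind [PathFreeMWIS.advance]
    have hr3 : r ∉ pending lab := by simp [hp]
    obtain ⟨k', hk', ht⟩ := h.trail z (.inl hz)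
    exact ⟨k' + 1, by omega, ht.extend (core_advance_subset hp)
      (mem_core.2 ⟨hr2, by simpa using hr3⟩) hzr fun _ => not_adj_of_mem_core_advance⟩
  link C hC := by
    rw [active_advance] at hC
    have := mem_active.1 hv
    exact .inl ⟨v, hconn C hC ▸ hv, by simp [PathFreeMWIS.advance, this, hzv]⟩

lemma TrailInvariant.card_pending_advance_add_le {d τ : ℕ} (h : TrailInvariant G A₀ k lab)
    (hτ : ∀ X k r, IsTrail G X k r → k < τ) (hA₀ : DegreesBelow G d A₀) (hz : lab z = 1) :
    #(pending (PathFreeMWIS.advance G lab z)) + (τ - (k + 1)) * d ≤ (τ - k) * d := by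
  classical
  obtain ⟨k', hk', ht⟩ := h.trail z (.inl hz)
  have hkτ : τ - k = τ - (k + 1) + 1 := by have := hτ _ _ _ ht; omega
  have hle : #(pending (PathFreeMWIS.advance G lab z)) ≤ d := by
    rw [pending_advance]
    exact (card_le_card (filter_subset_filter _ h.active_subset)).trans
      (hA₀ z (h.mem z hz.ge)).le
  calc _ ≤ d + (τ - (k + 1)) * d := by gcongr
    _ = (τ - k) * d := by rw [hkτ, Nat.succ_mul, add_comm]

variable [DecidableEq V]

lemma TrailInvariant.relabel_one (h : TrailInvariant G A₀ k lab) (hv : lab v = 3)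
    (hR : R = {v} ∨ R = closedNhd G (active lab) v) :
    TrailInvariant G A₀ k (relabel lab R 1) := by
  have hR2 : ∀ r ∈ R, 2 ≤ lab r := by
    rcases hR with rfl | rfl <;> grind [mem_closedNhd, mem_active]
  have hcore : core (relabel lab R 1) ⊆ core lab :=
    (core_relabel one_lt_two).trans_subset sdiff_subset
  refine ⟨fun x hx => h.mem x (by grind [relabel]), fun r hr => ?_, fun C hC => ?_⟩
  · by_cases hr' : lab r = 1 ∨ lab r = 3
    · obtain ⟨k', hk', ht⟩ := h.trail r hr'
      exact ⟨k', hk', ht.mono hcore⟩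
    · have hrR : r ∈ R := by grind [relabel]
      obtain rfl : R = closedNhd G (active lab) v := hR.resolve_left fun e => by grind
      obtain ⟨k', hk', ht⟩ := h.trail v (.inr hv)
      refine ⟨k' + 1, by omega, ht.extend hcore ?_ ?_ ?_⟩ <;>
        grind [mem_closedNhd, mem_active, mem_core, relabel]
  · rw [active_relabel one_lt_two] at hC
    by_cases hadj : ∃ r ∈ R, ∃ x ∈ C, G.Adj r x
    · obtain ⟨r, hr, hx⟩ := hadj
      exact .inr ⟨r, if_pos hr, hx⟩
    · push Not at hadj
      have hout : ∀ x ∈ C, x ∉ R := fun x hx => (mem_sdiff.1 (hC.subset hx)).2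
      refine (h.link C (hC.of_sdiff hadj)).imp ?_ ?_
      · exact fun ⟨x, hx, hx3⟩ => ⟨x, hx, by simp [relabel, hout x hx, hx3]⟩
      · exact fun ⟨r, hr, hx⟩ => ⟨r, by grind [relabel], hx⟩

lemma TrailInvariant.relabel_zero (h : TrailInvariant G A₀ k lab) (hp : pending lab = ∅)
    (hRA : R ⊆ active lab) (hR : IsUnionOfComponents G (active lab) (active lab \ R)) :
    TrailInvariant G A₀ k (relabel lab R 0) where
  mem x hx := h.mem x (by grind [relabel])
  trail r hr := by
    obtain ⟨k', hk', ht⟩ := h.trail r (by grind [relabel])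
    exact ⟨k', hk', ht.mono ((core_relabel two_pos).trans_subset sdiff_subset)⟩
  link C hC := by
    rw [active_relabel two_pos] at hC
    rcases h.link C (hR.trans hC) with ⟨x, -, hx⟩ | ⟨r, hr, hx⟩
    · exact absurd (mem_pending.2 hx) (by simp [hp])
    · refine .inr ⟨r, ?_, hx⟩
      have : r ∉ R := fun hrR => by simpa [hr] using hRA hrR
      simp [relabel, this, hr]

/-- Nothing has happened yet along an induced path: there are only active vertices outside the
frontier and discarded vertices. -/
def IsFresh (lab : V → ℕ) : Prop := ∀ x, lab x = 0 ∨ lab x = 2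

omit [Fintype V] in
lemma IsFresh.relabel_zero (h : IsFresh lab) : IsFresh (relabel lab R 0) := by
  grind [IsFresh, relabel]

lemma active_relabel_singleton (hv : v ∈ active lab) :
    active (relabel lab {v} 3) = active lab := by
  grind [mem_active, relabel]

lemma IsFresh.pending_relabel_singleton (h : IsFresh lab) :
    pending (relabel lab {v} 3) = {v} := by
  ext x
  have := h x
  grind [mem_pending, relabel]

lemma IsFresh.trailInvariant (h : IsFresh lab) (hconn : IsConnectedOn G (active lab))
    (hv : v ∈ active lab) : TrailInvariant G (active lab) 0 (relabel lab {v} 3) where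
  mem x hx := by
    have := h x
    grind [mem_active, relabel]
  trail r hr := by
    obtain rfl : r = v := by
      have := h r
      grind [relabel]
    exact ⟨0, le_rfl, isTrail_zero (by simp [relabel])⟩
  link C hC := by
    rw [active_relabel_singleton hv] at hC
    exact .inl ⟨v, hconn C hC ▸ hv, by simp [relabel]⟩

end TrailInvariant

section Bounds

variable {V : Type*} [Fintype V] [DecidableEq V] {G : SimpleGraph V} {A₀ : Finset V} {d τ k : ℕ}
  {lab : V → ℕ} {R : Finset V} {v z : V} {c c₁ c₂ e : ℕ}

lemma card_pending_relabel_lt (hv : lab v = 3) (hvR : v ∈ R) :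
    #(pending (relabel lab R 1)) < #(pending lab) := by
  rw [pending_relabel one_lt_two]
  exact card_lt_card
    ((ssubset_iff_of_subset sdiff_subset).2 ⟨v, by simp [hv], by simp [hvR]⟩)

lemma branch_bound (hv : lab v = 3) (hvR : v ∈ R)
    (h₁ : c₁ + 1 ≤ 2 * max #(active (relabel lab {v} 1)) 1 *
      2 ^ (#(pending (relabel lab {v} 1)) + e))
    (h₂ : c₂ + 1 ≤ 2 * max #(active (relabel lab R 1)) 1 *
      2 ^ (#(pending (relabel lab R 1)) + e)) :
    c₁ + c₂ + 1 + 1 ≤ 2 * max #(active lab) 1 * 2 ^ (#(pending lab) + e) := by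
  obtain ⟨p, hp⟩ : ∃ p, #(pending lab) = p + 1 :=
    Nat.exists_eq_add_one.2 (card_pos.2 ⟨v, mem_pending.2 hv⟩)
  have child_le : ∀ R', v ∈ R' → 2 * max #(active (relabel lab R' 1)) 1 *
      2 ^ (#(pending (relabel lab R' 1)) + e) ≤ 2 * max #(active lab) 1 * 2 ^ (p + e) := by
    intro R' hvR'
    have := card_pending_relabel_lt hv hvR'
    rw [active_relabel one_lt_two]
    gcongr
    · exact sdiff_subset
    · exact one_le_two
    · omega
  have := child_le {v} (by simp)
  have := child_le R hvR
  rw [hp, show p + 1 + e = p + e + 1 by ring, pow_succ]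
  linarith

omit [Fintype V] in
lemma split_bound {A C : Finset V} (hCA : C ⊆ A) (hC : C.Nonempty) (hAC : (A \ C).Nonempty)
    (h₁ : c₁ + 1 ≤ 2 * max #C 1 * 2 ^ e) (h₂ : c₂ + 1 ≤ 2 * max #(A \ C) 1 * 2 ^ e) :
    c₁ + c₂ + 1 + 1 ≤ 2 * max #A 1 * 2 ^ e := by
  have hcard := card_sdiff_add_card_eq_card hCA
  rw [max_eq_left hC.card_pos] at h₁
  rw [max_eq_left hAC.card_pos] at h₂
  rw [max_eq_left (hC.card_pos.trans_le (card_le_card hCA)), ← hcard]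
  linarith

lemma RecTree.le_of_trailInvariant (hτ : ∀ X k r, IsTrail G X k r → k < τ)
    (hA₀ : DegreesBelow G d A₀) (hc : RecTree G d lab c) (h : TrailInvariant G A₀ k lab) :
    c + 1 ≤ 2 * max #(active lab) 1 * 2 ^ (#(pending lab) + (τ - k) * d) := by
  classical
  induction hc generalizing k with
  | leaf hA => simp [hA, Nat.one_le_two_pow]
  | split hs _ _ ih₁ ih₂ =>
    have hsdiff := hs.isUnion.sdiff hs.ne
    have i₁ := ih₁ (h.relabel_zero hs.pending_eq sdiff_subset
      (by rw [Finset.sdiff_sdiff_eq_self hs.isUnion.subset]; exact hs.isUnion))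
    have i₂ := ih₂ (h.relabel_zero hs.pending_eq hs.isUnion.subset hsdiff)
    simp only [active_relabel two_pos, pending_relabel two_pos, hs.pending_eq, empty_sdiff,
      Finset.sdiff_sdiff_eq_self hs.isUnion.subset] at i₁ i₂ ⊢
    exact split_bound hs.isUnion.subset hs.isUnion.nonempty hsdiff.nonempty i₁ i₂
  | @branch lab _ v _ _ _ hp _ _ ih₁ ih₂ =>
    have hv := self_mem_closedNhd (G := G) hp.mem
    cases hp with
    | high hv hd => exact absurd (hA₀.mono h.active_subset v hv) hd.not_gt
    | frontier _ h3 =>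
      exact branch_bound h3 hv (ih₁ (h.relabel_one h3 (.inl rfl)))
        (ih₂ (h.relabel_one h3 (.inr rfl)))
    | @extend z _ _ hp hconn hz hvA hzv =>
      have h' := h.advance hp hconn hz hvA hzv
      have h3 : advance G lab z v = 3 := by
        have := mem_active.1 hvA
        simp [advance, this, hzv]
      have key := branch_bound h3 hv (ih₁ (h'.relabel_one h3 (.inl rfl)))
        (ih₂ (h'.relabel_one h3 (.inr (by rw [active_advance]))))
      rw [active_advance] at key
      refine key.trans ?_
      gcongr 2 * _ * 2 ^ ?_
      · exact one_le_two
      · rw [hp, card_empty, zero_add]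
        exact h.card_pending_advance_add_le hτ hA₀ hz
    | start _ hp _ hlink hvA =>
      rcases h.link _ (isUnionOfComponents_self ⟨v, hvA⟩) with ⟨x, -, hx⟩ | ⟨r, hr, x, hx, hrx⟩
      · exact absurd (mem_pending.2 hx) (by simp [hp])
      · exact absurd hrx (hlink r hr x hx)

lemma RecTree.le_of_degreesBelow (hτ : ∀ X k r, IsTrail G X k r → k < τ)
    (hA₀ : DegreesBelow G d A₀) (hc : RecTree G d lab c) (hlab : IsFresh lab)
    (hsub : active lab ⊆ A₀) : c + 1 ≤ 2 * max #(active lab) 1 * 2 ^ (1 + τ * d) := by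
  classical
  induction hc with
  | leaf hA => simp [hA, Nat.one_le_two_pow]
  | split hs _ _ ih₁ ih₂ =>
    have i₁ := ih₁ hlab.relabel_zero
    have i₂ := ih₂ hlab.relabel_zero
    simp only [active_relabel two_pos, Finset.sdiff_sdiff_eq_self hs.isUnion.subset] at i₁ i₂
    exact split_bound hs.isUnion.subset hs.isUnion.nonempty (hs.isUnion.sdiff hs.ne).nonempty
      (i₁ (hs.isUnion.subset.trans hsub)) (i₂ (sdiff_subset.trans hsub))
  | @branch lab _ v _ _ _ hp h₁ h₂ ih₁ ih₂ =>
    cases hp with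
    | high hv hd => exact absurd (hA₀.mono hsub v hv) hd.not_gt
    | frontier _ h3 => have := hlab v; omega
    | @extend z _ _ _ _ hz => have := hlab z; omega
    | start hd _ hconn _ hvA =>
      have hv := self_mem_closedNhd (G := G) hvA
      have h3 : relabel lab {v} 3 v = 3 := by simp [relabel]
      have hA := active_relabel_singleton hvA
      have hI := hlab.trailInvariant hconn hvA
      rw [← relabel_relabel (m' := 3) Subset.rfl] at h₁
      rw [← relabel_relabel (m' := 3) (singleton_subset_iff.2 hv)] at h₂
      have key := branch_bound h3 hv
        (h₁.le_of_trailInvariant hτ hd (hI.relabel_one h3 (.inl rfl)))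
        (h₂.le_of_trailInvariant hτ hd (hI.relabel_one h3 (.inr (by rw [hA]))))
      rwa [hA, hlab.pending_relabel_singleton, card_singleton] at key

lemma high_bound {q B : ℝ} {a a₁ a₂ : ℕ} (hB : 0 ≤ B) (hq : 1 ≤ q)
    (hqd : q ^ d + 1 ≤ q ^ (d + 1)) (ha₁ : a₁ + 1 = a) (ha₂ : a₂ + (d + 1) ≤ a)
    (h₁ : (c₁ : ℝ) + 1 ≤ B * q ^ a₁) (h₂ : (c₂ : ℝ) + 1 ≤ B * q ^ a₂) :
    (c₁ + c₂ + 1 : ℝ) + 1 ≤ B * q ^ a := by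
  obtain ⟨e, rfl⟩ : ∃ e, a = e + (d + 1) := ⟨a - (d + 1), by omega⟩
  obtain rfl : a₁ = e + d := by omega
  calc (c₁ : ℝ) + c₂ + 1 + 1 = (c₁ + 1) + (c₂ + 1) := by ring
    _ ≤ B * q ^ (e + d) + B * q ^ a₂ := add_le_add h₁ h₂
    _ ≤ B * q ^ (e + d) + B * q ^ e := by gcongr; omega
    _ = B * (q ^ e * (q ^ d + 1)) := by ring
    _ ≤ B * (q ^ e * q ^ (d + 1)) := by gcongr
    _ = B * q ^ (e + (d + 1)) := by rw [pow_add q e]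

lemma RecTree.le (hτ : ∀ X k r, IsTrail G X k r → k < τ) {q : ℝ} (hq : 1 ≤ q)
    (hqd : d < Fintype.card V → q ^ d + 1 ≤ q ^ (d + 1)) (hc : RecTree G d lab c)
    (hlab : IsFresh lab) :
    (c : ℝ) + 1 ≤ 2 * (Fintype.card V + 1) * 2 ^ (1 + τ * d) * q ^ #(active lab) := by
  classical
  have low_bound : ∀ {lab c}, RecTree G d lab c → IsFresh lab → DegreesBelow G d (active lab) →
      (c : ℝ) + 1 ≤ 2 * (Fintype.card V + 1) * 2 ^ (1 + τ * d) * q ^ #(active lab) := by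
    intro lab c hc hlab hd
    have hle : c + 1 ≤ 2 * (Fintype.card V + 1) * 2 ^ (1 + τ * d) := by
      refine (hc.le_of_degreesBelow hτ hd hlab Subset.rfl).trans ?_
      have := card_le_univ (active lab)
      gcongr
      omega
    exact (by exact_mod_cast hle : (c + 1 : ℝ) ≤ _).trans
      (le_mul_of_one_le_right (by positivity) (one_le_pow₀ hq))
  induction hc with
  | leaf h => exact low_bound (.leaf h) hlab (by simp [DegreesBelow, h])
  | split hs h₁ h₂ => exact low_bound (.split hs h₁ h₂) hlab hs.degreesBelow
  | @branch lab _ v _ _ _ hp h₁ h₂ ih₁ ih₂ =>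
    by_cases hd : DegreesBelow G d (active lab)
    · exact low_bound (.branch hp h₁ h₂) hlab hd
    cases hp with
    | high hv hdv =>
      have hcard := card_sdiff_add_card_eq_card
        (closedNhd_subset (G := G) (A := active lab) (v := v))
      rw [card_closedNhd hv] at hcard
      have := card_le_univ (active lab)
      push_cast
      refine high_bound (by positivity) hq (hqd (by omega)) ?_ ?_ (ih₁ hlab.relabel_zero)
        (ih₂ hlab.relabel_zero) <;> rw [active_relabel two_pos]
      · exact card_sdiff_add_card_eq_card (singleton_subset_iff.2 hv)
      · omega
    | _ => exact absurd ‹_› hd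

end Bounds

/-! ### Programs with bounded loops -/

-- The registers `order`, `pathOrder` and `result` and the arrays `adj`, `out` and `weight` are
-- numbered as in `inputState` and `IsOutput`.
namespace Reg

@[simp] abbrev order : ℕ := 0
@[simp] abbrev pathOrder : ℕ := 1
@[simp] abbrev one : ℕ := 2
@[simp] abbrev two : ℕ := 3
@[simp] abbrev three : ℕ := 4
@[simp] abbrev zero : ℕ := 5
@[simp] abbrev degBound : ℕ := 6
@[simp] abbrev base : ℕ := 7
@[simp] abbrev pivot : ℕ := 8
@[simp] abbrev witness : ℕ := 9
@[simp] abbrev newLabel : ℕ := 10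
@[simp] abbrev i : ℕ := 11
@[simp] abbrev j : ℕ := 12
@[simp] abbrev k : ℕ := 13
@[simp] abbrev flag : ℕ := 14
@[simp] abbrev count : ℕ := 15
@[simp] abbrev addr : ℕ := 16
@[simp] abbrev val : ℕ := 17
@[simp] abbrev edge : ℕ := 18
@[simp] abbrev mark : ℕ := 19
@[simp] abbrev found : ℕ := 20
@[simp] abbrev other : ℕ := 21
@[simp] abbrev nbrMark : ℕ := 22
@[simp] abbrev child : ℕ := 23
@[simp] abbrev power : ℕ := 24
@[simp] abbrev target : ℕ := 25
@[simp] abbrev square : ℕ := 26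
@[simp] abbrev increment : ℕ := 27
@[simp] abbrev twicePathOrder : ℕ := 28

end Reg

namespace Arr

@[simp] abbrev adj : ℕ := 0
@[simp] abbrev out : ℕ := 1
@[simp] abbrev label : ℕ := 2
@[simp] abbrev saved : ℕ := 3
@[simp] abbrev mark : ℕ := 4
@[simp] abbrev pivot : ℕ := 5
@[simp] abbrev row : ℕ := 6

end Arr

namespace WReg

@[simp] abbrev result : ℕ := 0
@[simp] abbrev tmp : ℕ := 1
@[simp] abbrev saved : ℕ := 2

end WReg

namespace WArr

@[simp] abbrev weight : ℕ := 0
@[simp] abbrev saved : ℕ := 1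

end WArr

/-- A storage location of the machine: a number register, a number array, a weight register or a
weight array. -/
inductive Loc where
  | reg (x : ℕ)
  | arr (a : ℕ)
  | wreg (u : ℕ)
  | warr (a : ℕ)
  deriving DecidableEq

/-- The location written by an instruction. -/
def target : Instr → Loc
  | .const x _ | .move x _ | .add x _ _ | .sub x _ _ | .load x _ _ => .reg x
  | .store a _ _ => .arr a
  | .wzero u | .wmove u _ | .wadd u _ _ | .wload u _ _ => .wreg u
  | .wstore a _ _ => .warr a

/-- Commands without recursion whose only loops `rep i p` run `p` with the register `i` counting
from `0` up to the number of vertices. -/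
inductive Code where
  | skip
  | instr (i : Instr)
  | seq (p q : Code)
  | branch (b : Test) (p q : Code)
  | rep (i : ℕ) (p : Code)

infixr:60 ";;" => Code.seq

instance : Coe Instr Code := ⟨Code.instr⟩

namespace Code

variable {p q : Code} {i n : ℕ} {s s' s'' : State}

/-- The locations written by a piece of code. -/
def writes : Code → List Loc
  | skip => []
  | instr i => [target i]
  | seq p q => p.writes ++ q.writes
  | branch _ p q => p.writes ++ q.writes
  | rep i p => .reg i :: p.writes

/-- The counters of the loops are not written in the bodies, and neither the number of vertices nor
the constant one is ever written. -/
def WellFormed : Code → Prop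
  | skip => True
  | instr i => target i ≠ .reg Reg.order ∧ target i ≠ .reg Reg.one
  | seq p q => p.WellFormed ∧ q.WellFormed
  | branch _ p q => p.WellFormed ∧ q.WellFormed
  | rep i p => (i ≠ Reg.order ∧ i ≠ Reg.one ∧ .reg i ∉ p.writes) ∧ p.WellFormed

instance decidableWellFormed : DecidablePred WellFormed
  | skip => inferInstanceAs (Decidable True)
  | instr _ => inferInstanceAs (Decidable (_ ∧ _))
  | seq p q => @instDecidableAnd _ _ (decidableWellFormed p) (decidableWellFormed q)
  | branch _ p q => @instDecidableAnd _ _ (decidableWellFormed p) (decidableWellFormed q)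
  | rep _ p => @instDecidableAnd _ _ inferInstance (decidableWellFormed p)

/-- The effect of incrementing the counter `i` after the loop body `p`. -/
def next (i : ℕ) (f : State → State) (s : State) : State := (Instr.add i i Reg.one).apply (f s)

open Classical in
/-- The effect of a piece of code on the state of the machine. -/
noncomputable def run : Code → State → State
  | skip, s => s
  | instr i, s => i.apply s
  | seq p q, s => q.run (p.run s)
  | branch b p q, s => if b.Holds s then p.run s else q.run s
  | rep i p, s => (next i p.run)^[s.reg Reg.order] ((Instr.const i 0).apply s)

/-- The translation of a piece of code into a command of the machine. -/
def compile : Code → Cmd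
  | skip => .skip
  | instr i => .instr i
  | seq p q => .seq p.compile q.compile
  | branch b p q => .branch b p.compile q.compile
  | rep i p => .seq (.instr (.const i 0))
      (.loop (.lt i Reg.order) (.seq p.compile (.instr (.add i i Reg.one))))

/-- An upper bound for the number of steps on graphs with `n` vertices. -/
def cost (n : ℕ) : Code → ℕ
  | skip => 1
  | instr _ => 1
  | seq p q => p.cost n + q.cost n
  | branch _ p q => p.cost n + q.cost n + 1
  | rep _ p => n * (p.cost n + 2) + 2

lemma run_skip (s : State) : skip.run s = s := rfl

lemma run_seq (p q : Code) (s : State) : (p ;; q).run s = q.run (p.run s) := rfl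

lemma run_assoc (p q r : Code) (s : State) : ((p ;; q) ;; r).run s = (p ;; q ;; r).run s := rfl

lemma run_branch_of {b : Test} (h : b.Holds s) : (branch b p q).run s = p.run s := if_pos h

lemma run_branch_of_not {b : Test} (h : ¬ b.Holds s) : (branch b p q).run s = q.run s := if_neg h

/-- The states `s` and `s'` differ at most in the locations written by `p`. -/
structure Frame (p : Code) (s s' : State) : Prop where
  reg : ∀ x, .reg x ∉ p.writes → s'.reg x = s.reg x
  arr : ∀ a, .arr a ∉ p.writes → s'.arr a = s.arr a
  wreg : ∀ u, .wreg u ∉ p.writes → s'.wreg u = s.wreg u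
  warr : ∀ a, .warr a ∉ p.writes → s'.warr a = s.warr a

lemma Frame.refl (p : Code) (s : State) : p.Frame s s :=
  ⟨fun _ _ => rfl, fun _ _ => rfl, fun _ _ => rfl, fun _ _ => rfl⟩

lemma Frame.trans (h : p.Frame s s') (h' : p.Frame s' s'') : p.Frame s s'' :=
  ⟨fun x hx => (h'.reg x hx).trans (h.reg x hx), fun x hx => (h'.arr x hx).trans (h.arr x hx),
    fun x hx => (h'.wreg x hx).trans (h.wreg x hx), fun x hx => (h'.warr x hx).trans (h.warr x hx)⟩

lemma Frame.mono (h : p.Frame s s') (hpq : p.writes ⊆ q.writes) : q.Frame s s' :=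
  ⟨fun x hx => h.reg x fun h => hx (hpq h), fun x hx => h.arr x fun h => hx (hpq h),
    fun x hx => h.wreg x fun h => hx (hpq h), fun x hx => h.warr x fun h => hx (hpq h)⟩

lemma frame_instr (i : Instr) (s : State) : (instr i).Frame s (i.apply s) := by
  constructor <;> intro x hx <;> cases i <;> simp_all [Instr.apply, writes, target]

lemma frame_rep_const (i : ℕ) (p : Code) (s : State) :
    (rep i p).Frame s ((Instr.const i 0).apply s) :=
  (frame_instr _ s).mono (by simp [writes, target])

lemma frame_rep_next (h : p.Frame s (p.run s)) : (rep i p).Frame s (next i p.run s) :=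
  (h.mono (List.subset_cons_self _ _)).trans ((frame_instr _ _).mono (by simp [writes, target]))

lemma Frame.iterate {f : State → State} (h : ∀ s, p.Frame s (f s)) (k : ℕ) (s : State) :
    p.Frame s (f^[k] s) := by
  induction k with
  | zero => exact .refl _ _
  | succ k ih =>
    rw [Function.iterate_succ_apply']
    exact ih.trans (h _)

lemma frame_run (p : Code) (s : State) : p.Frame s (p.run s) := by
  induction p generalizing s with
  | skip => exact .refl _ _
  | instr i => exact frame_instr i s
  | seq p q ihp ihq =>
    exact ((ihp s).mono (List.subset_append_left _ _)).trans
      ((ihq _).mono (List.subset_append_right _ _))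
  | branch b p q ihp ihq =>
    by_cases hb : b.Holds s
    · rw [run_branch_of hb]
      exact (ihp s).mono (List.subset_append_left _ _)
    · rw [run_branch_of_not hb]
      exact (ihq s).mono (List.subset_append_right _ _)
  | rep i p ih =>
    exact (frame_rep_const i p s).trans (.iterate (fun s => frame_rep_next (ih s)) _ _)

/-- The code `p` does not write to any location of the list `L`. -/
def Avoids (p : Code) (L : List Loc) : Prop := ∀ ℓ ∈ L, ℓ ∉ p.writes

instance (p : Code) (L : List Loc) : Decidable (p.Avoids L) :=
  inferInstanceAs (Decidable (∀ ℓ ∈ L, ℓ ∉ p.writes))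

lemma WellFormed.reg_notMem_writes (h : p.WellFormed) :
    .reg Reg.order ∉ p.writes ∧ .reg Reg.one ∉ p.writes := by
  induction p with
  | skip => simp [writes]
  | instr i => simpa [writes, WellFormed, eq_comm] using h
  | seq p q ihp ihq | branch _ p q ihp ihq => simp_all [writes, WellFormed]
  | rep i p ih =>
    obtain ⟨⟨h0, h1, -⟩, hp⟩ := h
    simp_all [writes, eq_comm]

lemma run_reg_order (h : p.WellFormed) : (p.run s).reg Reg.order = s.reg Reg.order :=
  (frame_run p s).reg _ h.reg_notMem_writes.1

lemma run_reg_one (h : p.WellFormed) : (p.run s).reg Reg.one = s.reg Reg.one :=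
  (frame_run p s).reg _ h.reg_notMem_writes.2

section Round

/-- The state before the `k`-th round of the loop `rep i p` started in the state `s`. -/
noncomputable def round (i : ℕ) (p : Code) (s : State) (k : ℕ) : State :=
  (next i p.run)^[k] ((Instr.const i 0).apply s)

lemma round_succ (i : ℕ) (p : Code) (s : State) (k : ℕ) :
    round i p s (k + 1) = next i p.run (round i p s k) :=
  Function.iterate_succ_apply' _ _ _

lemma frame_round (i : ℕ) (p : Code) (s : State) (k : ℕ) : (rep i p).Frame s (round i p s k) :=
  (frame_rep_const i p s).trans (.iterate (fun s => frame_rep_next (frame_run p s)) _ _)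

lemma next_run_reg_counter (h : (rep i p).WellFormed) (h1 : s.reg Reg.one = 1) :
    (next i p.run s).reg i = s.reg i + 1 := by
  simp [next, Instr.apply, (frame_run p s).reg i h.1.2.2, run_reg_one h.2, h1]

lemma round_reg_order (h : (rep i p).WellFormed) (k : ℕ) :
    (round i p s k).reg Reg.order = s.reg Reg.order :=
  (frame_round i p s k).reg _ h.reg_notMem_writes.1

lemma round_reg_one (h : (rep i p).WellFormed) (k : ℕ) :
    (round i p s k).reg Reg.one = s.reg Reg.one :=
  (frame_round i p s k).reg _ h.reg_notMem_writes.2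

lemma round_reg_counter (h : (rep i p).WellFormed) (h1 : s.reg Reg.one = 1) (k : ℕ) :
    (round i p s k).reg i = k := by
  induction k with
  | zero => simp [round, Instr.apply]
  | succ k ih => rw [round_succ, next_run_reg_counter h ((round_reg_one h k).trans h1), ih]

end Round

section Exec

variable {ps : List Cmd} {c : ℕ}

lemma exec_rounds (h : (rep i p).WellFormed) (h1 : s.reg Reg.one = 1)
    (hp : ∀ k, ∃ T ≤ c, Exec ps p.compile (round i p s k) T (p.run (round i p s k))) (j : ℕ) :
    ∀ k, k + j = s.reg Reg.order → ∃ T ≤ j * (c + 2) + 1,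
      Exec ps (.loop (.lt i Reg.order) (.seq p.compile (.instr (.add i i Reg.one))))
        (round i p s k) T (round i p s (s.reg Reg.order)) := by
  induction j with
  | zero =>
    rintro k rfl
    exact ⟨1, by omega, .loop_false (by
      simp [Test.Holds, round_reg_counter h h1, round_reg_order h])⟩
  | succ j ih =>
    intro k hk
    obtain ⟨T, hT, hE⟩ := hp k
    obtain ⟨T', hT', hrest⟩ := ih (k + 1) (by omega)
    refine ⟨T + 1 + T' + 1, by linarith, .loop_true ?_ (.seq hE (.instr _ _)) ?_⟩
    · simp only [Test.Holds, round_reg_counter h h1, round_reg_order h]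
      omega
    · rw [round_succ] at hrest
      exact hrest

lemma exec_compile (ps : List Cmd) (hp : p.WellFormed) (h1 : s.reg Reg.one = 1) :
    ∃ T ≤ p.cost (s.reg Reg.order), Exec ps p.compile s T (p.run s) := by
  induction p generalizing s with
  | skip => exact ⟨1, le_rfl, .skip s⟩
  | instr i => exact ⟨1, le_rfl, .instr i s⟩
  | seq p q ihp ihq =>
    obtain ⟨T, hT, hE⟩ := ihp hp.1 h1
    obtain ⟨T', hT', hE'⟩ := ihq hp.2 ((run_reg_one hp.1).trans h1)
    rw [run_reg_order hp.1] at hT'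
    exact ⟨T + T', Nat.add_le_add hT hT', .seq hE hE'⟩
  | branch b p q ihp ihq =>
    obtain ⟨T, hT, hE⟩ := ihp hp.1 h1
    obtain ⟨T', hT', hE'⟩ := ihq hp.2 h1
    by_cases hb : b.Holds s
    · rw [run_branch_of hb]
      exact ⟨T + 1, by simp only [cost]; omega, .branch_true hb hE⟩
    · rw [run_branch_of_not hb]
      exact ⟨T' + 1, by simp only [cost]; omega, .branch_false hb hE'⟩
  | rep i p ih =>
    have exec_round : ∀ k, ∃ T ≤ p.cost (s.reg Reg.order),
        Exec ps p.compile (round i p s k) T (p.run (round i p s k)) := by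
      intro k
      simpa only [round_reg_order hp] using ih hp.2 ((round_reg_one hp k).trans h1)
    obtain ⟨T, hT, hE⟩ := exec_rounds hp h1 exec_round (s.reg Reg.order) 0 (by omega)
    exact ⟨1 + T, by simp only [cost]; omega, .seq (.instr _ _) hE⟩

lemma exists_cost_le (p : Code) : ∃ k, ∀ n, p.cost n ≤ (n + 2) ^ k := by
  have add_le : ∀ k l n : ℕ, (n + 2) ^ k + (n + 2) ^ l + 1 ≤ (n + 2) ^ (k + l + 2) := by
    intro k l n
    have hk : (n + 2) ^ k ≤ (n + 2) ^ (k + l) := Nat.pow_le_pow_right (by omega) (by omega)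
    have hl : (n + 2) ^ l ≤ (n + 2) ^ (k + l) := Nat.pow_le_pow_right (by omega) (by omega)
    have h1 : 1 ≤ (n + 2) ^ (k + l) := Nat.one_le_pow _ _ (by omega)
    calc _ ≤ (n + 2) ^ (k + l) * 2 ^ 2 := by omega
      _ ≤ (n + 2) ^ (k + l) * (n + 2) ^ 2 := by gcongr; omega
      _ = _ := (pow_add _ _ 2).symm
  induction p with
  | skip | instr _ => exact ⟨0, fun n => by simp [cost]⟩
  | seq p q ihp ihq | branch _ p q ihp ihq =>
    obtain ⟨k, hk⟩ := ihp
    obtain ⟨l, hl⟩ := ihq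
    refine ⟨k + l + 2, fun n => le_trans ?_ (add_le k l n)⟩
    have := hk n
    have := hl n
    simp only [cost]
    omega
  | rep i p ih =>
    obtain ⟨k, hk⟩ := ih
    refine ⟨k + 2 + 1, fun n => ?_⟩
    have := add_le k 0 n
    calc n * (p.cost n + 2) + 2 ≤ (p.cost n + 2) * (n + 2) := by nlinarith
      _ ≤ (n + 2) ^ (k + 2) * (n + 2) := by
        gcongr
        have := hk n
        simp only [pow_zero, add_zero] at *
        omega
      _ = (n + 2) ^ (k + 2 + 1) := (pow_succ _ _).symm

end Exec

section Loops

lemma run_rep_induction (h : (rep i p).WellFormed) (hn : s.reg Reg.order = n)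
    (h1 : s.reg Reg.one = 1) (I : ℕ → State → Prop)
    (zero : I 0 ((Instr.const i 0).apply s))
    (succ : ∀ (v : Fin n) (s' : State), s'.reg i = v → (rep i p).Frame s s' → I v s' →
      I (v + 1) (next i p.run s')) : I n ((rep i p).run s) := by
  have round_spec : ∀ k ≤ n, I k (round i p s k) := by
    intro k hk
    induction k with
    | zero => exact zero
    | succ k ih =>
      rw [round_succ]
      exact succ ⟨k, hk⟩ _ (round_reg_counter h h1 k) (frame_round i p s k) (ih (by omega))
  have := round_spec n le_rfl
  rwa [← hn] at this ⊢

end Loops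

section Search

variable {r : ℕ}

/-- The conditional that runs `p` if all tests of the list hold, and `q` otherwise. -/
def ifAll (p q : Code) : List Test → Code
  | [] => p
  | b :: bs => branch b (ifAll p q bs) q

/-- Records in the register `flag` whether all tests of the list hold. -/
def check : List Test → Code := ifAll (Instr.const Reg.flag 1) (Instr.const Reg.flag 0)

/-- Searches for a vertex `i` for which `q` raises the flag. The register `r` gets the last such
vertex, or the number of vertices if there is none. -/
def search (r i : ℕ) (q : Code) : Code :=
  Instr.move r Reg.order ;; rep i (q ;; ifAll (Instr.move r i) skip [.eq Reg.flag Reg.one])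

/-- Raises the flag if there is a vertex `i` for which `q` raises the flag. -/
def any (i : ℕ) (q : Code) : Code :=
  search Reg.other i q ;; check [.lt Reg.other Reg.order]

/-- Counts the vertices `i` for which `q` raises the flag. -/
def countAll (i : ℕ) (q : Code) : Code :=
  Instr.const Reg.count 0 ;; rep i (q ;; Instr.add Reg.count Reg.count Reg.flag)

/-- For every vertex `i` stores the value computed by `q` at the address computed by `q`. -/
def fill (a i : ℕ) (q : Code) : Code := rep i (q ;; Instr.store a Reg.addr Reg.val)

/-- The number `k` is a vertex with the property `P`, or `n` if there is no such vertex. -/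
def Finds (n : ℕ) (P : Fin n → Prop) (k : ℕ) : Prop :=
  (k = n ∧ ∀ v, ¬ P v) ∨ ∃ v : Fin n, k = v ∧ P v

lemma Finds.lt_iff {P : Fin n → Prop} {k : ℕ} (h : Finds n P k) : k < n ↔ ∃ v, P v := by
  rcases h with ⟨rfl, h⟩ | ⟨v, rfl, h⟩
  · simpa using h
  · simpa using ⟨v, h⟩

open Classical in
lemma run_ifAll (p q : Code) (bs : List Test) (s : State) :
    (ifAll p q bs).run s = if ∀ b ∈ bs, b.Holds s then p.run s else q.run s := by
  induction bs with
  | nil => simp [ifAll]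
  | cons b bs ih =>
    by_cases hb : b.Holds s
    · simp [ifAll, run_branch_of hb, ih, hb]
    · simp [ifAll, run_branch_of_not hb, hb]

lemma run_ifAll_eq (p q : Code) (x y : ℕ) (s : State) :
    (ifAll p q [.eq x y]).run s = if s.reg x = s.reg y then p.run s else q.run s := by
  simp [run_ifAll, Test.Holds]

lemma run_ifAll_lt (p q : Code) (x y : ℕ) (s : State) :
    (ifAll p q [.lt x y]).run s = if s.reg x < s.reg y then p.run s else q.run s := by
  simp [run_ifAll, Test.Holds]

open Classical in
lemma run_check_reg (bs : List Test) (s : State) (x : ℕ) :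
    ((check bs).run s).reg x = if x = Reg.flag then if ∀ b ∈ bs, b.Holds s then 1 else 0
      else s.reg x := by
  rw [check, run_ifAll]
  split_ifs <;> simp_all [run, Instr.apply]

lemma frame_seq_left (p q : Code) (s : State) : (p ;; q).Frame s (p.run s) :=
  (frame_run p s).mono (List.subset_append_left _ _)

lemma run_search (hp : (search r i q).WellFormed) (hr : (rep i q).Avoids [.reg r])
    (hn : s.reg Reg.order = n) (h1 : s.reg Reg.one = 1) {P : Fin n → Prop}
    [DecidablePred P]
    (hq : ∀ (v : Fin n) s', (search r i q).Frame s s' → s'.reg i = v →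
      (q.run s').reg Reg.flag = if P v then 1 else 0) :
    Finds n P (((search r i q).run s).reg r) := by
  have hqr : .reg r ∉ (rep i q).writes := hr _ (by simp)
  simp only [writes, List.mem_cons, Loc.reg.injEq, not_or] at hqr
  obtain ⟨⟨hr0, hr1⟩, hrep⟩ := hp
  simp only [target, ne_eq, Loc.reg.injEq] at hr0 hr1
  set s₀ := (Instr.move r Reg.order).apply s with hs₀
  have hn₀ : s₀.reg Reg.order = n := by simp [hs₀, Instr.apply, Ne.symm hr0, hn]
  have h1₀ : s₀.reg Reg.one = 1 := by simp [hs₀, Instr.apply, Ne.symm hr1, h1]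
  have key : ((search r i q).run s).reg r = n ∧ (∀ v : Fin n, (v : ℕ) < n → ¬ P v) ∨
      ∃ v : Fin n, ((search r i q).run s).reg r = v ∧ P v := by
    refine run_rep_induction hrep hn₀ h1₀ (fun k s' =>
      s'.reg r = n ∧ (∀ v : Fin n, (v : ℕ) < k → ¬ P v) ∨ ∃ v : Fin n, s'.reg r = v ∧ P v)
      (by simp [hs₀, Instr.apply, hqr.1, hn]) fun v s' hi hs' ih => ?_
    have hf := hq v s' ((frame_seq_left _ _ s).trans (hs'.mono (List.subset_append_right _ _))) hi
    have hr' := (frame_run q s').reg r hqr.2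
    have hi' := (frame_run q s').reg i (by simp_all [WellFormed, writes])
    have h1' := (frame_run q s').reg Reg.one hrep.2.1.reg_notMem_writes.2
    have h1s := hs'.reg Reg.one hrep.reg_notMem_writes.2
    by_cases hv : P v
    · refine .inr ⟨v, ?_, hv⟩
      simp [next, run, run_ifAll, Instr.apply, Test.Holds, hf, hv, hqr.1, h1', h1s, h1₀, hi', hi]
    · have : (next i (q ;; ifAll (Instr.move r i) skip [.eq Reg.flag Reg.one]).run s').reg r =
          s'.reg r := by
        simp [next, run, run_ifAll, Instr.apply, Test.Holds, hf, hv, hqr.1, h1', h1s, h1₀, hr']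
      rw [this]
      refine ih.imp_left fun h => ⟨h.1, fun u hu => ?_⟩
      rcases Nat.lt_succ_iff_lt_or_eq.1 hu with hu | hu
      · exact h.2 u hu
      · rwa [Fin.ext hu]
  exact key.imp_left fun h => ⟨h.1, fun v => h.2 v v.2⟩

lemma run_any (hp : (any i q).WellFormed) (hi : (rep i q).Avoids [.reg Reg.other])
    (hn : s.reg Reg.order = n) (h1 : s.reg Reg.one = 1) {P : Fin n → Prop}
    [DecidablePred P] [Decidable (∃ v, P v)]
    (hq : ∀ (v : Fin n) s', (any i q).Frame s s' → s'.reg i = v →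
      (q.run s').reg Reg.flag = if P v then 1 else 0) :
    ((any i q).run s).reg Reg.flag = if ∃ v, P v then 1 else 0 := by
  have hsearch : Finds n P (((search Reg.other i q).run s).reg Reg.other) :=
    run_search hp.1 hi hn h1 fun v s' hs' => hq v s' (hs'.mono (List.subset_append_left _ _))
  rw [any, run_seq, run_check_reg, if_pos rfl]
  simp [Test.Holds, run_reg_order hp.1, hn, ← hsearch.lt_iff]

lemma run_countAll (hp : (countAll i q).WellFormed) (hi : (rep i q).Avoids [.reg Reg.count])
    (hn : s.reg Reg.order = n) (h1 : s.reg Reg.one = 1) {P : Fin n → Prop} [DecidablePred P]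
    (hq : ∀ (v : Fin n) s', (countAll i q).Frame s s' → s'.reg i = v →
      (q.run s').reg Reg.flag = if P v then 1 else 0) :
    ((countAll i q).run s).reg Reg.count = #{v | P v} := by
  have hqc : .reg Reg.count ∉ (rep i q).writes := hi _ (by simp)
  simp only [writes, List.mem_cons, Loc.reg.injEq, not_or] at hqc
  have key : ((countAll i q).run s).reg Reg.count = #{v : Fin n | (v : ℕ) < n ∧ P v} := by
    refine run_rep_induction hp.2 (by simpa [Instr.apply]) (by simpa [Instr.apply])
      (fun k s' => s'.reg Reg.count = #{v : Fin n | (v : ℕ) < k ∧ P v})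
      (by simp [run, Instr.apply, hqc.1]) fun v s' hv hs' ih => ?_
    have hf := hq v s' ((frame_seq_left _ _ s).trans (hs'.mono (List.subset_append_right _ _))) hv
    have hc := (frame_run q s').reg Reg.count hqc.2
    have hsplit : #{u : Fin n | (u : ℕ) < v + 1 ∧ P u} =
        #{u : Fin n | (u : ℕ) < v ∧ P u} + if P v then 1 else 0 := by
      have heq : ({u : Fin n | (u : ℕ) < v + 1 ∧ P u} : Finset _) =
          if P v then insert v ({u : Fin n | (u : ℕ) < v ∧ P u} : Finset _)
          else ({u : Fin n | (u : ℕ) < v ∧ P u} : Finset _) := by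
        grind [Fin.ext_iff]
      rw [heq]
      split_ifs <;> simp
    rw [hsplit, ← ih]
    simp [next, run, Instr.apply, hf, hc, hqc.1]
  simpa using key

lemma run_fill {a b : ℕ} (hp : (fill a i q).WellFormed) (ha : q.Avoids [.arr a])
    (hn : s.reg Reg.order = n) (h1 : s.reg Reg.one = 1) {f : Fin n → ℕ}
    (hq : ∀ (v : Fin n) s', (fill a i q).Frame s s' → s'.reg i = v →
      (∀ c, c < b ∨ b + v ≤ c → s'.arr a c = s.arr a c) →
      (q.run s').reg Reg.addr = b + v ∧ (q.run s').reg Reg.val = f v) :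
    (∀ v : Fin n, ((fill a i q).run s).arr a (b + v) = f v) ∧
      ∀ c, c < b ∨ b + n ≤ c → ((fill a i q).run s).arr a c = s.arr a c := by
  have key : (∀ v : Fin n, (v : ℕ) < n → ((fill a i q).run s).arr a (b + v) = f v) ∧
      ∀ c, c < b ∨ b + n ≤ c → ((fill a i q).run s).arr a c = s.arr a c := by
    refine run_rep_induction hp hn h1 (fun k s' =>
      (∀ v : Fin n, (v : ℕ) < k → s'.arr a (b + v) = f v) ∧
        ∀ c, c < b ∨ b + k ≤ c → s'.arr a c = s.arr a c)
      (by simp [Instr.apply]) fun v s' hv hs' ih => ?_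
    obtain ⟨haddr, hval⟩ := hq v s' hs' hv ih.2
    have harr := (frame_run q s').arr a (ha _ (by simp))
    have heq : (next i (q ;; Instr.store a Reg.addr Reg.val).run s').arr a =
        Function.update (s'.arr a) (b + v) (f v) := by
      simp [next, run, Instr.apply, haddr, hval, harr]
    simp only [heq, Function.update_apply]
    refine ⟨fun u hu => ?_, fun c hc => ?_⟩
    · split_ifs with huv
      · rw [Fin.ext (Nat.add_left_cancel huv)]
      · exact ih.1 u (by omega)
    · rw [if_neg (by omega)]
      exact ih.2 c (by omega)
  exact ⟨fun v => key.1 v v.2, key.2⟩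

end Search

end Code

/-! ### Selection of the pivot -/

section NodeState

variable {n d : ℕ} {G : SimpleGraph (Fin n)} {w : Fin n → ℝ≥0} {lab : Fin n → ℕ}
  {s s' : State} {p : Code}

open Classical in
/-- The tables and constants that stay fixed throughout the recursion are in place. -/
structure Ambient (G : SimpleGraph (Fin n)) (w : Fin n → ℝ≥0) (d : ℕ) (s : State) : Prop where
  order : s.reg Reg.order = n
  one : s.reg Reg.one = 1
  two : s.reg Reg.two = 2
  three : s.reg Reg.three = 3
  zero : s.reg Reg.zero = 0
  degBound : s.reg Reg.degBound = d
  adj : ∀ x y : Fin n, s.arr Arr.adj (n * x + y) = if G.Adj x y then 1 else 0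
  row : ∀ x : Fin n, s.arr Arr.row x = n * x
  weight : ∀ x : Fin n, s.warr WArr.weight x = w x

/-- The locations described by `Ambient`. -/
def ambientLocs : List Loc :=
  [.reg Reg.order, .reg Reg.one, .reg Reg.two, .reg Reg.three, .reg Reg.zero, .reg Reg.degBound,
    .arr Arr.adj, .arr Arr.row, .warr WArr.weight]

/-- The current node of the recursion tree is given by the labelling `lab`, stored in the label
stack from the cell `base` on. -/
structure AtNode (G : SimpleGraph (Fin n)) (w : Fin n → ℝ≥0) (d : ℕ) (lab : Fin n → ℕ)
    (s : State) : Prop extends Ambient G w d s where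
  label : ∀ x : Fin n, s.arr Arr.label (s.reg Reg.base + x) = lab x

/-- The locations described by `AtNode`. -/
def nodeLocs : List Loc := .reg Reg.base :: .arr Arr.label :: ambientLocs

lemma Ambient.of_frame (h : Ambient G w d s) (hs : p.Frame s s') (hp : p.Avoids ambientLocs) :
    Ambient G w d s' where
  order := (hs.reg _ (hp _ (by decide))).trans h.order
  one := (hs.reg _ (hp _ (by decide))).trans h.one
  two := (hs.reg _ (hp _ (by decide))).trans h.two
  three := (hs.reg _ (hp _ (by decide))).trans h.three
  zero := (hs.reg _ (hp _ (by decide))).trans h.zero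
  degBound := (hs.reg _ (hp _ (by decide))).trans h.degBound
  adj x y := by rw [hs.arr _ (hp _ (by decide)), h.adj]
  row x := by rw [hs.arr _ (hp _ (by decide)), h.row]
  weight x := by rw [hs.warr _ (hp _ (by decide)), h.weight]

lemma Ambient.run (h : Ambient G w d s) (hp : p.Avoids ambientLocs) : Ambient G w d (p.run s) :=
  h.of_frame (p.frame_run s) hp

lemma AtNode.of_frame (h : AtNode G w d lab s) (hs : p.Frame s s') (hp : p.Avoids nodeLocs) :
    AtNode G w d lab s' where
  toAmbient := h.toAmbient.of_frame hs fun ℓ hℓ =>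
    hp ℓ (List.mem_cons_of_mem _ (List.mem_cons_of_mem _ hℓ))
  label x := by rw [hs.arr _ (hp _ (by decide)), hs.reg _ (hp _ (by decide)), h.label]

lemma AtNode.run (h : AtNode G w d lab s) (hp : p.Avoids nodeLocs) : AtNode G w d lab (p.run s) :=
  h.of_frame (p.frame_run s) hp

section Queries

open Code

/-- Reads the label of the vertex in the register `x` into the register `r`. -/
def getLabel (r x : ℕ) : Code := Instr.add Reg.addr Reg.base x ;; Instr.load r Arr.label Reg.addr

/-- Reads into the register `r` the entry of the adjacency matrix for the vertices in the registers
`x` and `y`. -/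
def getEdge (r x y : ℕ) : Code :=
  Instr.load Reg.addr Arr.row x ;; Instr.add Reg.addr Reg.addr y ;; Instr.load r Arr.adj Reg.addr

def findActive : Code :=
  search Reg.witness Reg.i (getLabel Reg.val Reg.i ;; check [.le Reg.two Reg.val])

def findPending : Code :=
  search Reg.pivot Reg.i (getLabel Reg.val Reg.i ;; check [.eq Reg.val Reg.three])

/-- Counts the active neighbours of the vertex `i`. -/
def countNeighbours : Code :=
  countAll Reg.j (getLabel Reg.val Reg.j ;; getEdge Reg.edge Reg.i Reg.j ;;
    check [.le Reg.two Reg.val, .eq Reg.edge Reg.one])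

def findHigh : Code :=
  search Reg.pivot Reg.i (countNeighbours ;; getLabel Reg.val Reg.i ;;
    check [.le Reg.two Reg.val, .le Reg.degBound Reg.count])

attribute [local simp] Code.run Instr.apply Test.Holds getLabel getEdge run_check_reg

lemma run_findActive (h : AtNode G w d lab s) :
    Finds n (· ∈ active lab) ((findActive.run s).reg Reg.witness) := by
  refine run_search (by decide) (by decide) h.order h.one fun v s' hs hv => ?_
  have h' : AtNode G w d lab s' := h.of_frame hs (by decide)
  simp [hv, h'.two, h'.label]

lemma run_findPending (h : AtNode G w d lab s) :
    Finds n (fun v => lab v = 3) ((findPending.run s).reg Reg.pivot) := by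
  refine run_search (by decide) (by decide) h.order h.one fun v s' hs hv => ?_
  have h' : AtNode G w d lab s' := h.of_frame hs (by decide)
  simp [hv, h'.three, h'.label]

open Classical in
lemma run_countNeighbours (h : AtNode G w d lab s) {v : Fin n} (hv : s.reg Reg.i = v) :
    (countNeighbours.run s).reg Reg.count = #{x ∈ active lab | G.Adj v x} := by
  rw [active, filter_filter]
  refine run_countAll (by decide) (by decide) h.order h.one fun x s' hs hx => ?_
  have h' : AtNode G w d lab s' := h.of_frame hs (by decide)
  have hv' : s'.reg Reg.i = v := (hs.reg _ (by decide)).trans hv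
  simp [hv', hx, h'.one, h'.two, h'.label, h'.row, h'.adj]

open Classical in
lemma run_findHigh (h : AtNode G w d lab s) :
    Finds n (fun v => v ∈ active lab ∧ d ≤ #{x ∈ active lab | G.Adj v x})
      ((findHigh.run s).reg Reg.pivot) := by
  refine run_search (by decide) (by decide) h.order h.one fun v s' hs hv => ?_
  have h' : AtNode G w d lab s' := h.of_frame hs (by decide)
  have hcount := run_countNeighbours h' hv
  have h'' := h'.run (p := countNeighbours) (by decide)
  have hv'' : (countNeighbours.run s').reg Reg.i = v :=
    ((frame_run _ _).reg _ (by decide)).trans hv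
  rw [run_seq]
  simp [hcount, hv'', h''.two, h''.label, h''.degBound]

end Queries

end NodeState

section Stack

variable {n d b : ℕ} {G : SimpleGraph (Fin n)} {w : Fin n → ℝ≥0} {lab : Fin n → ℕ}
  {A C : Finset (Fin n)} {a : Fin n} {s s' s'' : State} {p : Code}

lemma isConnectedOn_of_forall_subset (ha : a ∈ A)
    (h : ∀ D, IsUnionOfComponents G A D → a ∈ D → A ⊆ D) : IsConnectedOn G A := by
  intro D hD
  by_contra hne
  have haD : a ∉ D := fun haD => hne (hD.subset.antisymm (h D hD haD))
  obtain ⟨x, hx⟩ := hD.nonempty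
  exact (mem_sdiff.1 (h _ (hD.sdiff hne) (mem_sdiff.2 ⟨ha, haD⟩) (hD.subset hx))).2 hx

/-- The states agree on all stack cells below the address `b`. -/
structure SameBelow (b : ℕ) (s s' : State) : Prop where
  label : ∀ c < b, s'.arr Arr.label c = s.arr Arr.label c
  saved : ∀ c < b, s'.arr Arr.saved c = s.arr Arr.saved c
  pivot : ∀ c < b, s'.arr Arr.pivot c = s.arr Arr.pivot c
  weight : ∀ c < b, s'.warr WArr.saved c = s.warr WArr.saved c

/-- The stacks. -/
def stackLocs : List Loc :=
  [.arr Arr.label, .arr Arr.saved, .arr Arr.pivot, .warr WArr.saved]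

lemma SameBelow.trans (h : SameBelow b s s') (h' : SameBelow b s' s'') : SameBelow b s s'' where
  label c hc := (h'.label c hc).trans (h.label c hc)
  saved c hc := (h'.saved c hc).trans (h.saved c hc)
  pivot c hc := (h'.pivot c hc).trans (h.pivot c hc)
  weight c hc := (h'.weight c hc).trans (h.weight c hc)

lemma SameBelow.mono {b' : ℕ} (h : SameBelow b' s s') (hb : b ≤ b') : SameBelow b s s' where
  label c hc := h.label c (hc.trans_le hb)
  saved c hc := h.saved c (hc.trans_le hb)
  pivot c hc := h.pivot c (hc.trans_le hb)
  weight c hc := h.weight c (hc.trans_le hb)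

lemma sameBelow_run (hp : p.Avoids stackLocs) (b : ℕ) (s : State) : SameBelow b s (p.run s) where
  label c _ := by rw [(p.frame_run s).arr _ (hp _ (by decide))]
  saved c _ := by rw [(p.frame_run s).arr _ (hp _ (by decide))]
  pivot c _ := by rw [(p.frame_run s).arr _ (hp _ (by decide))]
  weight c _ := by rw [(p.frame_run s).warr _ (hp _ (by decide))]

open Code

section Component

/-- The vertices of `C` are the marked ones. -/
def Marks (C : Finset (Fin n)) (s : State) : Prop :=
  ∀ x : Fin n, s.arr Arr.mark x = if x ∈ C then 1 else 0

def clearMarks : Code := fill Arr.mark Reg.i (Instr.move Reg.addr Reg.i ;; Instr.const Reg.val 0)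

/-- Finds an active vertex that is not marked but has a marked neighbour. -/
def findBoundary : Code :=
  search Reg.found Reg.i (any Reg.j (getLabel Reg.val Reg.i ;; getEdge Reg.edge Reg.j Reg.i ;;
    Instr.load Reg.mark Arr.mark Reg.i ;; Instr.load Reg.nbrMark Arr.mark Reg.j ;;
    check [.le Reg.two Reg.val, .ne Reg.mark Reg.one, .eq Reg.nbrMark Reg.one,
      .eq Reg.edge Reg.one]))

def markBoundary : Code :=
  findBoundary ;; ifAll (Instr.store Arr.mark Reg.found Reg.one) skip [.lt Reg.found Reg.order]

def markWitness : Code := clearMarks ;; Instr.store Arr.mark Reg.witness Reg.one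

/-- Marks the component of the vertex `witness`: one new vertex per round until nothing changes. -/
def markComponent : Code := markWitness ;; rep Reg.k markBoundary

def findUnmarked : Code :=
  search Reg.found Reg.i (getLabel Reg.val Reg.i ;; Instr.load Reg.mark Arr.mark Reg.i ;;
    check [.le Reg.two Reg.val, .ne Reg.mark Reg.one])

attribute [local simp] Code.run Instr.apply Test.Holds getLabel getEdge run_check_reg

lemma Marks.of_frame (h : Marks C s) (hs : p.Frame s s') (hp : p.Avoids [.arr Arr.mark]) :
    Marks C s' := fun x => by rw [hs.arr _ (hp _ (by decide)), h x]

open Classical in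
lemma run_findBoundary (h : AtNode G w d lab s) (hC : Marks C s) :
    Finds n (fun y => ∃ x, y ∈ active lab ∧ y ∉ C ∧ x ∈ C ∧ G.Adj x y)
      ((findBoundary.run s).reg Reg.found) := by
  refine run_search (by decide) (by decide) h.order h.one fun y s' hs hy => ?_
  have h' : AtNode G w d lab s' := h.of_frame hs (by decide)
  refine run_any (by decide) (by decide) h'.order h'.one fun x s'' hs' hx => ?_
  have h'' : AtNode G w d lab s'' := h'.of_frame hs' (by decide)
  have hy' : s''.reg Reg.i = y := (hs'.reg _ (by decide)).trans hy
  have hC' : Marks C s'' := (hC.of_frame hs (by decide)).of_frame hs' (by decide)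
  simp [hy', hx, h''.one, h''.two, h''.label, h''.row, h''.adj, hC' _]

lemma run_markBoundary (h : AtNode G w d lab s) (hC : Marks C s) :
    (Marks C (markBoundary.run s) ∧ ∀ x ∈ C, ∀ y ∈ active lab, G.Adj x y → y ∈ C) ∨
      ∃ x ∈ C, ∃ y ∈ active lab, y ∉ C ∧ G.Adj x y ∧ Marks (insert y C) (markBoundary.run s) := by
  have h' : AtNode G w d lab (findBoundary.run s) := h.run (by decide)
  have hC' : Marks C (findBoundary.run s) := hC.of_frame (frame_run _ _) (by decide)
  rw [markBoundary, run_seq, run_ifAll]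
  rcases run_findBoundary h hC with ⟨hr, hnone⟩ | ⟨y, hr, x, hy, hyC, hx, hadj⟩
  · refine .inl ⟨?_, by grind⟩
    simpa [hr, h'.order] using hC'
  · refine .inr ⟨x, hx, y, hy, hyC, hadj, fun z => ?_⟩
    rcases eq_or_ne z y with rfl | hzy
    · simp [hr, h'.order, h'.one]
    · simp [hr, h'.order, h'.one, hC' z, hzy, Fin.val_ne_of_ne hzy]

lemma run_clearMarks (h : AtNode G w d lab s) : Marks (∅ : Finset (Fin n)) (clearMarks.run s) := by
  have hfill : ∀ v : Fin n, (clearMarks.run s).arr Arr.mark (0 + v) = 0 :=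
    (run_fill (by decide) (by decide) h.order h.one fun v s' _ hv _ => by simp [hv]).1
  exact fun v => by simpa using hfill v

/-- The marked vertices form part of the component of `a` in the graph induced on `A`: either all
of it or more than `k` vertices. -/
def PartlyMarked (G : SimpleGraph (Fin n)) (A : Finset (Fin n)) (a : Fin n) (k : ℕ) (s : State) :
    Prop :=
  ∃ C, Marks C s ∧ a ∈ C ∧ C ⊆ A ∧ (∀ D, IsUnionOfComponents G A D → a ∈ D → C ⊆ D) ∧
    ((∀ x ∈ C, ∀ y ∈ A, G.Adj x y → y ∈ C) ∨ k < #C)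

lemma PartlyMarked.run_markBoundary {k : ℕ} (h : AtNode G w d lab s)
    (hk : PartlyMarked G (active lab) a k s) :
    PartlyMarked G (active lab) a (k + 1) (markBoundary.run s) := by
  obtain ⟨C, hC, haC, hCA, hmin, hclosed⟩ := hk
  rcases PathFreeMWIS.run_markBoundary h hC with ⟨hm, hcl⟩ | ⟨x, hx, y, hy, hyC, hxy, hm⟩
  · exact ⟨C, hm, haC, hCA, hmin, .inl hcl⟩
  · refine ⟨insert y C, hm, mem_insert_of_mem haC, insert_subset hy hCA, fun D hD haD =>
      insert_subset (hD.closed x (hmin D hD haD hx) y hy hxy) (hmin D hD haD), .inr ?_⟩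
    rw [card_insert_of_notMem hyC]
    have := hclosed.resolve_left fun hcl => hyC (hcl x hx y hy hxy)
    omega

lemma run_markWitness (h : AtNode G w d lab s) (hw : s.reg Reg.witness = a) :
    Marks {a} (markWitness.run s) := by
  intro x
  have hclear := run_clearMarks h x
  have hw' : (clearMarks.run s).reg Reg.witness = a := ((frame_run _ _).reg _ (by decide)).trans hw
  have h1 : (clearMarks.run s).reg Reg.one = 1 := ((frame_run _ _).reg _ (by decide)).trans h.one
  simp only [notMem_empty, if_false] at hclear
  simp [markWitness, hw', h1, hclear, Function.update_apply, Fin.ext_iff]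

lemma run_markComponent (h : AtNode G w d lab s) (ha : a ∈ active lab)
    (hw : s.reg Reg.witness = a) :
    ∃ C, Marks C (markComponent.run s) ∧ IsUnionOfComponents G (active lab) C ∧
      ∀ D, IsUnionOfComponents G (active lab) D → a ∈ D → C ⊆ D := by
  have h₁ : AtNode G w d lab (markWitness.run s) := h.run (by decide)
  have key : PartlyMarked G (active lab) a n (markComponent.run s) :=
    run_rep_induction (i := Reg.k) (p := markBoundary) (by decide) h₁.order h₁.one
      (fun k s' => PartlyMarked G (active lab) a k s')
      ⟨{a}, run_markWitness h hw, by simp, by simpa using ha, by simp, .inr (by simp)⟩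
      fun v s' _ hs' ih => ih.run_markBoundary (h₁.of_frame hs' (by decide))
  obtain ⟨C, hC, haC, hCA, hmin, hclosed⟩ := key
  exact ⟨C, hC, ⟨hCA, ⟨a, haC⟩, hclosed.resolve_right (by simpa using card_le_univ C)⟩, hmin⟩

lemma run_findUnmarked (h : AtNode G w d lab s) (hC : Marks C s) :
    Finds n (fun v => v ∈ active lab ∧ v ∉ C) ((findUnmarked.run s).reg Reg.found) := by
  refine run_search (by decide) (by decide) h.order h.one fun v s' hs hv => ?_
  have h' : AtNode G w d lab s' := h.of_frame hs (by decide)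
  have hC' : Marks C s' := hC.of_frame hs (by decide)
  simp [hv, h'.one, h'.two, h'.label, hC' _]

end Component

end Stack

section Select

variable {n d : ℕ} {G : SimpleGraph (Fin n)} {w : Fin n → ℝ≥0} {lab : Fin n → ℕ}
  {C : Finset (Fin n)} {a : Fin n} {s s' : State} {p : Code}

open Code

/-- Finds a vertex with label `1` that has an active neighbour. -/
def findLink : Code :=
  search Reg.found Reg.i (any Reg.j (getLabel Reg.mark Reg.i ;; getLabel Reg.val Reg.j ;;
    getEdge Reg.edge Reg.i Reg.j ;;
    check [.eq Reg.mark Reg.one, .le Reg.two Reg.val, .eq Reg.edge Reg.one]))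

/-- Finds an active neighbour of the vertex `found`. -/
def findNeighbour : Code :=
  search Reg.pivot Reg.j (getLabel Reg.val Reg.j ;; getEdge Reg.edge Reg.found Reg.j ;;
    check [.le Reg.two Reg.val, .eq Reg.edge Reg.one])

/-- Passes to the labelling `advance G lab z` for the vertex `z` in the register `found`. -/
def advanceLabels : Code :=
  fill Arr.label Reg.i (getEdge Reg.edge Reg.found Reg.i ;; getLabel Reg.val Reg.i ;;
    ifAll (ifAll (Instr.const Reg.val 3) (Instr.const Reg.val 2) [.eq Reg.edge Reg.one])
      (Instr.const Reg.val 0) [.le Reg.two Reg.val])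

/-- Selection of the pivot when the graph on the active vertices is connected. -/
def selectConnected : Code :=
  findLink ;; ifAll (findNeighbour ;; advanceLabels) (Instr.move Reg.pivot Reg.witness)
    [.lt Reg.found Reg.order]

/-- Selection when there is neither a vertex of high degree nor a frontier. -/
def selectOffFrontier : Code :=
  markComponent ;; findUnmarked ;; ifAll selectConnected skip [.eq Reg.found Reg.order]

/-- Selection when there is no vertex of high degree. -/
def selectLowDegree : Code :=
  Instr.const Reg.newLabel 1 ;; findPending ;;
    ifAll selectOffFrontier skip [.eq Reg.pivot Reg.order]

/-- Decides how to respond to a labelling with active vertex `witness`: either `pivot` becomes the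
vertex to branch on, or `pivot` becomes the number of vertices and the marks describe a split. -/
def select : Code :=
  Instr.const Reg.newLabel 0 ;; findHigh ;; ifAll selectLowDegree skip [.eq Reg.pivot Reg.order]

/-- The outcome of the selection for the labelling `lab`. -/
inductive Selects (G : SimpleGraph (Fin n)) (w : Fin n → ℝ≥0) (d : ℕ) (lab : Fin n → ℕ)
    (s : State) : Prop
  | pivot {lab' : Fin n → ℕ} {v : Fin n} : AtNode G w d lab' s → s.reg Reg.pivot = v →
      IsPivot G d lab lab' v (s.reg Reg.newLabel) → Selects G w d lab s
  | split {C : Finset (Fin n)} : AtNode G w d lab s → s.reg Reg.pivot = n → Marks C s →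
      IsSplit G d lab C → Selects G w d lab s

attribute [local simp] Code.run Instr.apply Test.Holds getLabel getEdge run_check_reg

open Classical in
lemma run_findLink (h : AtNode G w d lab s) :
    Finds n (fun z => ∃ x, lab z = 1 ∧ x ∈ active lab ∧ G.Adj z x)
      ((findLink.run s).reg Reg.found) := by
  refine run_search (by decide) (by decide) h.order h.one fun z s' hs hz => ?_
  have h' : AtNode G w d lab s' := h.of_frame hs (by decide)
  refine run_any (by decide) (by decide) h'.order h'.one fun x s'' hs' hx => ?_
  have h'' : AtNode G w d lab s'' := h'.of_frame hs' (by decide)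
  have hz' : s''.reg Reg.i = z := (hs'.reg _ (by decide)).trans hz
  simp [hz', hx, h''.one, h''.two, h''.label, h''.row, h''.adj]

open Classical in
lemma run_findNeighbour (h : AtNode G w d lab s) {z : Fin n} (hz : s.reg Reg.found = z) :
    Finds n (fun x => x ∈ active lab ∧ G.Adj z x) ((findNeighbour.run s).reg Reg.pivot) := by
  refine run_search (by decide) (by decide) h.order h.one fun x s' hs hx => ?_
  have h' : AtNode G w d lab s' := h.of_frame hs (by decide)
  have hz' : s'.reg Reg.found = z := (hs.reg _ (by decide)).trans hz
  simp [hz', hx, h'.one, h'.two, h'.label, h'.row, h'.adj]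

lemma run_advanceLabels (h : AtNode G w d lab s) {z : Fin n} (hz : s.reg Reg.found = z) :
    AtNode G w d (advance G lab z) (advanceLabels.run s) ∧
      SameBelow (s.reg Reg.base) s (advanceLabels.run s) := by
  have hf := frame_run advanceLabels s
  obtain ⟨hlab, hlow⟩ : (∀ v : Fin n, (advanceLabels.run s).arr Arr.label (s.reg Reg.base + v) =
      advance G lab z v) ∧ _ :=
    run_fill (by decide) (by decide) h.order h.one fun v s' hs hv hread => by
      have h' : Ambient G w d s' := h.toAmbient.of_frame hs (by decide)
      have hb : s'.reg Reg.base = s.reg Reg.base := hs.reg _ (by decide)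
      have hz' : s'.reg Reg.found = z := (hs.reg _ (by decide)).trans hz
      have hl : s'.arr Arr.label (s.reg Reg.base + v) = lab v :=
        (hread _ (.inr le_rfl)).trans (h.label v)
      by_cases hv2 : 2 ≤ lab v <;> by_cases hzv : G.Adj z v <;>
        simp [run_ifAll, advance, hv, hb, hz', hl, hv2, hzv, h'.one, h'.two, h'.row, h'.adj]
  refine ⟨⟨h.toAmbient.run (by decide), fun x => ?_⟩, fun c hc => hlow c (.inl hc), ?_, ?_, ?_⟩
  · rw [hf.reg _ (by decide), hlab]
  · exact fun c _ => by rw [hf.arr _ (by decide)]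
  · exact fun c _ => by rw [hf.arr _ (by decide)]
  · exact fun c _ => by rw [hf.warr _ (by decide)]

lemma run_selectConnected (h : AtNode G w d lab s) (hdeg : DegreesBelow G d (active lab))
    (hpend : pending lab = ∅) (hconn : IsConnectedOn G (active lab)) (ha : a ∈ active lab)
    (hw : s.reg Reg.witness = a) (hm : s.reg Reg.newLabel = 1) :
    Selects G w d lab (selectConnected.run s) ∧
      SameBelow (s.reg Reg.base) s (selectConnected.run s) := by
  have hf := frame_run findLink s
  have h₁ : AtNode G w d lab (findLink.run s) := h.run (by decide)
  have hm₁ : (findLink.run s).reg Reg.newLabel = 1 := (hf.reg _ (by decide)).trans hm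
  have same₁ := sameBelow_run (p := findLink) (by decide) (s.reg Reg.base) s
  rw [selectConnected, run_seq, run_ifAll_lt, h₁.order]
  rcases run_findLink h with ⟨hz, hnone⟩ | ⟨z, hz, x, hlabz, hx, hzx⟩
  · rw [if_neg hz.not_lt]
    refine ⟨.pivot (h₁.run (by decide)) (v := a) ?_ ?_, same₁.trans (sameBelow_run (by decide) _ _)⟩
    · simp [hf.reg Reg.witness (by decide), hw]
    · rw [(frame_run _ _).reg _ (by decide), hm₁]
      exact .start hdeg hpend hconn (fun z hz x hx hzx => hnone z ⟨x, hz, hx, hzx⟩) ha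
  · rw [if_pos (hz.trans_lt z.2), run_seq]
    have h₂ : AtNode G w d lab (findNeighbour.run (findLink.run s)) := h₁.run (by decide)
    have hf₂ := frame_run findNeighbour (findLink.run s)
    have hb₂ : (findNeighbour.run (findLink.run s)).reg Reg.base = s.reg Reg.base :=
      (hf₂.reg _ (by decide)).trans (hf.reg _ (by decide))
    obtain ⟨h₃, same₃⟩ := run_advanceLabels h₂ (z := z) ((hf₂.reg _ (by decide)).trans hz)
    rw [hb₂] at same₃
    have hf₃ := frame_run advanceLabels (findNeighbour.run (findLink.run s))
    obtain ⟨-, hnone⟩ | ⟨y, hy, hyA, hzy⟩ := run_findNeighbour h₁ hz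
    · exact absurd ⟨hx, hzx⟩ (hnone x)
    · refine ⟨.pivot h₃ ((hf₃.reg _ (by decide)).trans hy) ?_,
        (same₁.trans (sameBelow_run (by decide) _ _)).trans same₃⟩
      rw [hf₃.reg _ (by decide), hf₂.reg _ (by decide), hm₁]
      exact .extend hdeg hpend hconn hlabz hyA hzy

lemma run_selectOffFrontier (h : AtNode G w d lab s) (hdeg : DegreesBelow G d (active lab))
    (hpend : pending lab = ∅) (ha : a ∈ active lab) (hw : s.reg Reg.witness = a)
    (hm : s.reg Reg.newLabel = 1) (hp : s.reg Reg.pivot = n) :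
    Selects G w d lab (selectOffFrontier.run s) ∧
      SameBelow (s.reg Reg.base) s (selectOffFrontier.run s) := by
  obtain ⟨C, hC, hCA, hmin⟩ := run_markComponent h ha hw
  have hf := frame_run (markComponent ;; findUnmarked) s
  have h₁ : AtNode G w d lab (markComponent.run s) := h.run (by decide)
  have h₂ : AtNode G w d lab ((markComponent ;; findUnmarked).run s) := h.run (by decide)
  have same := sameBelow_run (p := markComponent ;; findUnmarked) (by decide) (s.reg Reg.base) s
  have hb := hf.reg Reg.base (by decide)
  rw [selectOffFrontier, ← run_assoc, run_seq, run_ifAll_eq, h₂.order]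
  have hfind := run_findUnmarked h₁ hC
  rw [← run_seq] at hfind
  rcases hfind with ⟨hr, hnone⟩ | ⟨v, hr, hv, hvC⟩
  · rw [if_pos hr]
    have hsub : active lab ⊆ C := fun x hx => by_contra fun hxC => hnone x ⟨hx, hxC⟩
    have hconn := isConnectedOn_of_forall_subset ha fun D hD haD => hsub.trans (hmin D hD haD)
    obtain ⟨hsel, hsame⟩ := run_selectConnected h₂ hdeg hpend hconn ha
      ((hf.reg _ (by decide)).trans hw) ((hf.reg _ (by decide)).trans hm)
    exact ⟨hsel, same.trans (hb ▸ hsame)⟩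
  · rw [if_neg (hr.trans_ne v.2.ne)]
    exact ⟨.split h₂ ((hf.reg _ (by decide)).trans hp) (hC.of_frame (frame_run _ _) (by decide))
      ⟨hdeg, hpend, hCA, fun hCA' => hvC (hCA' ▸ hv)⟩, same⟩

lemma run_selectLowDegree (h : AtNode G w d lab s) (hdeg : DegreesBelow G d (active lab))
    (ha : a ∈ active lab) (hw : s.reg Reg.witness = a) :
    Selects G w d lab (selectLowDegree.run s) ∧
      SameBelow (s.reg Reg.base) s (selectLowDegree.run s) := by
  set p := Instr.const Reg.newLabel 1 ;; findPending with hp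
  have hf := frame_run p s
  have h₁ : AtNode G w d lab (p.run s) := h.run (by decide)
  have hm : (p.run s).reg Reg.newLabel = 1 := (frame_run findPending _).reg _ (by decide)
  have same := sameBelow_run (p := p) (by decide) (s.reg Reg.base) s
  have hb := hf.reg Reg.base (by decide)
  have hfind : Finds n (fun v => lab v = 3) ((p.run s).reg Reg.pivot) :=
    run_findPending (h.run (p := Instr.const Reg.newLabel 1) (by decide))
  rw [selectLowDegree, ← run_assoc, run_seq, run_ifAll_eq, ← hp, h₁.order]
  rcases hfind with ⟨hr, hnone⟩ | ⟨v, hr, hv⟩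
  · rw [if_pos hr]
    have hpend : pending lab = ∅ := by ext x; simpa using hnone x
    obtain ⟨hsel, hsame⟩ := run_selectOffFrontier h₁ hdeg hpend ha
      ((hf.reg _ (by decide)).trans hw) hm hr
    exact ⟨hsel, same.trans (hb ▸ hsame)⟩
  · rw [if_neg (hr.trans_ne v.2.ne)]
    refine ⟨.pivot h₁ hr ?_, same⟩
    rw [run_skip, hm]
    exact .frontier hdeg hv

lemma run_select (h : AtNode G w d lab s) (ha : a ∈ active lab) (hw : s.reg Reg.witness = a) :
    Selects G w d lab (select.run s) ∧ SameBelow (s.reg Reg.base) s (select.run s) := by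
  set p := Instr.const Reg.newLabel 0 ;; findHigh with hp
  have hf := frame_run p s
  have h₁ : AtNode G w d lab (p.run s) := h.run (by decide)
  have hm : (p.run s).reg Reg.newLabel = 0 := (frame_run findHigh _).reg _ (by decide)
  have same := sameBelow_run (p := p) (by decide) (s.reg Reg.base) s
  have hb := hf.reg Reg.base (by decide)
  have hfind := run_findHigh (h.run (p := Instr.const Reg.newLabel 0) (by decide))
  rw [← run_seq, ← hp] at hfind
  rw [select, ← run_assoc, run_seq, run_ifAll_eq, ← hp, h₁.order]
  rcases hfind with ⟨hr, hnone⟩ | ⟨v, hr, hv, hvd⟩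
  · rw [if_pos hr]
    have hdeg : DegreesBelow G d (active lab) := fun u hu => by simpa [hu] using hnone u
    obtain ⟨hsel, hsame⟩ := run_selectLowDegree h₁ hdeg ha ((hf.reg _ (by decide)).trans hw)
    exact ⟨hsel, same.trans (hb ▸ hsame)⟩
  · rw [if_neg (hr.trans_ne v.2.ne)]
    refine ⟨.pivot h₁ hr ?_, same⟩
    rw [run_skip, hm]
    exact .high hv hvd

end Select

/-! ### The recursive procedure -/

section Optimal

variable {V : Type*} {G : SimpleGraph V} {w : V → ℝ≥0} {A C S S₁ S₂ : Finset V} {v : V}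

/-- `S` is an independent set of maximum weight among the independent subsets of `A`. -/
structure IsOptimal (G : SimpleGraph V) (w : V → ℝ≥0) (A S : Finset V) : Prop where
  subset : S ⊆ A
  isIndepSet : G.IsIndepSet (S : Set V)
  le : ∀ S' ⊆ A, G.IsIndepSet (S' : Set V) → ∑ x ∈ S', w x ≤ ∑ x ∈ S, w x

lemma isOptimal_empty : IsOptimal G w ∅ ∅ :=
  ⟨Subset.rfl, by simp [SimpleGraph.IsIndepSet], fun S' hS' _ => by simp [subset_empty.1 hS']⟩

variable [DecidableEq V]

lemma isIndepSet_insert (hS : S ⊆ A \ closedNhd G A v)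
    (h : G.IsIndepSet (S : Set V)) : G.IsIndepSet (insert v S : Finset V) := by
  rw [coe_insert]
  refine h.insert fun x hx _ => ?_
  have hx' := mem_sdiff.1 (hS hx)
  have hvx : ¬ G.Adj v x := fun hvx => hx'.2 (mem_closedNhd.2 ⟨hx'.1, .inr hvx⟩)
  exact ⟨hvx, fun hxv => hvx hxv.symm⟩

lemma notMem_of_subset_sdiff_closedNhd (hv : v ∈ A) (hS : S ⊆ A \ closedNhd G A v) : v ∉ S :=
  fun hvS => (mem_sdiff.1 (hS hvS)).2 (self_mem_closedNhd hv)

lemma isOptimal_pivot (hv : v ∈ A) (h₁ : IsOptimal G w (A \ {v}) S₁)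
    (h₂ : IsOptimal G w (A \ closedNhd G A v) S₂) :
    IsOptimal G w A (if ∑ x ∈ S₁, w x < ∑ x ∈ insert v S₂, w x then insert v S₂ else S₁) where
  subset := by
    split_ifs
    · exact insert_subset hv (h₂.subset.trans sdiff_subset)
    · exact h₁.subset.trans sdiff_subset
  isIndepSet := by
    split_ifs
    · exact isIndepSet_insert h₂.subset h₂.isIndepSet
    · exact h₁.isIndepSet
  le S' hS' hind := by
    have le_max : ∑ x ∈ S', w x ≤ max (∑ x ∈ S₁, w x) (∑ x ∈ insert v S₂, w x) := by
      by_cases hvS : v ∈ S'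
      · refine le_max_of_le_right ?_
        rw [← add_sum_erase _ _ hvS,
          sum_insert (notMem_of_subset_sdiff_closedNhd hv h₂.subset)]
        refine add_le_add le_rfl
          (h₂.le _ (fun x hx => ?_) (hind.mono (coe_subset.2 (erase_subset _ _))))
        obtain ⟨hxv, hxS⟩ := mem_erase.1 hx
        have hvx : ¬ G.Adj v x := hind hvS hxS hxv.symm
        simp [hS' hxS, hxv, hvx]
      · exact le_max_of_le_left (h₁.le _ (subset_sdiff.2 ⟨hS', by simpa using hvS⟩) hind)
    split_ifs with hlt
    · rwa [max_eq_right hlt.le] at le_max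
    · rwa [max_eq_left (not_lt.1 hlt)] at le_max

lemma isOptimal_split (hC : IsUnionOfComponents G A C) (h₁ : IsOptimal G w (A \ (A \ C)) S₁)
    (h₂ : IsOptimal G w (A \ C) S₂) : Disjoint S₁ S₂ ∧ IsOptimal G w A (S₁ ∪ S₂) := by
  rw [Finset.sdiff_sdiff_eq_self hC.subset] at h₁
  have hdisj : Disjoint S₁ S₂ := disjoint_sdiff.mono h₁.subset h₂.subset
  refine ⟨hdisj, union_subset (h₁.subset.trans hC.subset) (h₂.subset.trans sdiff_subset), ?_, ?_⟩
  · rw [coe_union]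
    refine Set.pairwise_union.2 ⟨h₁.isIndepSet, h₂.isIndepSet, fun x hx y hy _ => ?_⟩
    have hy' := mem_sdiff.1 (h₂.subset hy)
    have hxy : ¬ G.Adj x y := fun hxy => hy'.2 (hC.closed x (h₁.subset hx) y hy'.1 hxy)
    exact ⟨hxy, fun hyx => hxy hyx.symm⟩
  · intro S' hS' hind
    rw [sum_union hdisj, ← sum_inter_add_sum_sdiff S' C]
    exact add_le_add (h₁.le _ inter_subset_right (hind.mono (coe_subset.2 inter_subset_left)))
      (h₂.le _ (sdiff_subset_sdiff hS' Subset.rfl) (hind.mono (coe_subset.2 sdiff_subset)))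

end Optimal

section Build

variable {n d b : ℕ} {G : SimpleGraph (Fin n)} {w : Fin n → ℝ≥0} {lab : Fin n → ℕ}
  {C : Finset (Fin n)} {v x : Fin n} {s s' : State} {q : Code}

open Code

/-- Fills the block of labels from the cell `child` on. The code `q` computes the new label of the
vertex `i` in the register `val` from the old one. -/
def fillChild (q : Code) : Code :=
  fill Arr.label Reg.i (getEdge Reg.edge Reg.pivot Reg.i ;; Instr.load Reg.mark Arr.mark Reg.i ;;
    getLabel Reg.val Reg.i ;; q ;; Instr.add Reg.addr Reg.child Reg.i)

/-- The new label of the vertex `i` in the first child. -/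
def firstLabel : Code :=
  ifAll (ifAll (Instr.move Reg.val Reg.newLabel) skip [.eq Reg.i Reg.pivot])
    (ifAll (Instr.const Reg.val 0) skip [.le Reg.two Reg.val, .ne Reg.mark Reg.one])
    [.lt Reg.pivot Reg.order]

/-- The new label of the vertex `i` in the second child. -/
def secondLabel : Code :=
  ifAll (ifAll (Instr.move Reg.val Reg.newLabel)
      (ifAll (Instr.move Reg.val Reg.newLabel) skip [.le Reg.two Reg.val, .eq Reg.edge Reg.one])
      [.eq Reg.i Reg.pivot])
    (ifAll (Instr.const Reg.val 0) skip [.eq Reg.mark Reg.one])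
    [.lt Reg.pivot Reg.order]

def buildFirst : Code :=
  (Instr.store Arr.pivot Reg.base Reg.pivot ;; Instr.add Reg.child Reg.base Reg.order) ;;
    fillChild firstLabel

def buildSecond : Code :=
  Instr.add Reg.child Reg.child Reg.order ;; fillChild secondLabel ;;
    Instr.move Reg.base Reg.child

/-- Stores the labels of the two children in the two blocks after the current one, and passes to
the second child. -/
def build : Code := buildFirst ;; buildSecond

/-- In the state `s'` the data of the vertex `x` have been loaded; the loop over the vertices was
started in the state `s`. -/
structure AtVertex (G : SimpleGraph (Fin n)) (w : Fin n → ℝ≥0) (d : ℕ) (lab : Fin n → ℕ)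
    (s : State) (x : Fin n) (s' : State) : Prop extends Ambient G w d s' where
  counter : s'.reg Reg.i = x
  pivot : s'.reg Reg.pivot = s.reg Reg.pivot
  newLabel : s'.reg Reg.newLabel = s.reg Reg.newLabel
  val : s'.reg Reg.val = lab x
  mark : s'.reg Reg.mark = s.arr Arr.mark x
  edge_iff : ∀ v : Fin n, s.reg Reg.pivot = v → (s'.reg Reg.edge = 1 ↔ G.Adj v x)

attribute [local simp] Code.run Instr.apply Test.Holds getLabel getEdge run_ifAll

lemma run_fillChild {f : Fin n → ℕ} (h : AtNode G w d lab s)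
    (hbc : s.reg Reg.base + n ≤ s.reg Reg.child) (hq : (fillChild q).WellFormed)
    (hqa : (fillChild q).Avoids (.reg Reg.base :: .reg Reg.child :: .reg Reg.pivot ::
      .reg Reg.newLabel :: .arr Arr.mark :: ambientLocs)) (hql : q.Avoids [.arr Arr.label])
    (hf : ∀ x s', AtVertex G w d lab s x s' → (q.run s').reg Reg.val = f x) :
    (∀ x : Fin n, ((fillChild q).run s).arr Arr.label (s.reg Reg.child + x) = f x) ∧
      ∀ c < s.reg Reg.child, ((fillChild q).run s).arr Arr.label c = s.arr Arr.label c := by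
  have hsub : q.writes ⊆ (fillChild q).writes := fun ℓ hℓ => by simp [fillChild, fill, writes, hℓ]
  have hi : .reg Reg.i ∉ q.writes := fun hi => hq.1.2.2 (by simp [writes, hi])
  refine (run_fill hq ?_ h.order h.one fun x s' hs hx hread => ?_).imp_right
    fun hlow c hc => hlow c (.inl hc)
  · simpa [Avoids, writes, target] using hql
  · set p := getEdge Reg.edge Reg.pivot Reg.i ;; Instr.load Reg.mark Arr.mark Reg.i ;;
      getLabel Reg.val Reg.i with hp
    have h' : Ambient G w d s' := h.toAmbient.of_frame hs fun ℓ hℓ => hqa ℓ (by simp [hℓ])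
    have hp' : AtVertex G w d lab s x (p.run s') :=
      { h'.run (by decide) with
        counter := ((frame_run p s').reg _ (by decide)).trans hx
        pivot := ((frame_run p s').reg _ (by decide)).trans (hs.reg _ (hqa _ (by simp)))
        newLabel := ((frame_run p s').reg _ (by decide)).trans (hs.reg _ (hqa _ (by simp)))
        val := by
          rw [← h.label x, ← hread _ (.inl (by omega))]
          simp [hp, hx, hs.reg Reg.base (hqa _ (by simp))]
        mark := by simp [hp, hx, hs.arr Arr.mark (hqa _ (by simp))]
        edge_iff := fun v hv => by
          simp [hp, hx, hs.reg Reg.pivot (hqa _ (by simp)), hv, h'.row, h'.adj] }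
    change ((Instr.add Reg.addr Reg.child Reg.i).apply (q.run (p.run s'))).reg Reg.addr = _ ∧
      ((Instr.add Reg.addr Reg.child Reg.i).apply (q.run (p.run s'))).reg Reg.val = _
    have hchild : (q.run (p.run s')).reg Reg.child = s.reg Reg.child :=
      ((frame_run q _).reg _ fun hc => hqa _ (by simp) (hsub hc)).trans
        (((frame_run p s').reg _ (by decide)).trans (hs.reg _ (hqa _ (by simp))))
    have hcounter : (q.run (p.run s')).reg Reg.i = x :=
      ((frame_run q _).reg _ hi).trans hp'.counter
    simp [hchild, hcounter, hf x _ hp']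

lemma run_firstLabel_pivot (h : AtVertex G w d lab s x s') (hv : s.reg Reg.pivot = v) :
    (firstLabel.run s').reg Reg.val = relabel lab {v} (s.reg Reg.newLabel) x := by
  by_cases hxv : x = v
  · simp [firstLabel, relabel, h.order, h.pivot, h.counter, h.newLabel, hv, hxv]
  · simp [firstLabel, relabel, h.order, h.pivot, h.counter, h.val, hv, hxv, Fin.val_ne_of_ne hxv]

lemma run_secondLabel_pivot (h : AtVertex G w d lab s x s') (hv : s.reg Reg.pivot = v)
    (hva : v ∈ active lab) :
    (secondLabel.run s').reg Reg.val =
      relabel lab (closedNhd G (active lab) v) (s.reg Reg.newLabel) x := by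
  by_cases hxv : x = v
  · simp [secondLabel, relabel, h.order, h.pivot, h.counter, h.newLabel, hv, hxv, mem_active.1 hva]
  · have hxv' := Fin.val_ne_of_ne hxv
    by_cases hx2 : 2 ≤ lab x <;> by_cases hvx : G.Adj v x <;>
      simp [secondLabel, relabel, h.order, h.one, h.two, h.pivot, h.counter, h.val, h.newLabel, hv,
        hxv, hxv', hx2, hvx, h.edge_iff v hv]

lemma run_firstLabel_split (h : AtVertex G w d lab s x s') (hp : s.reg Reg.pivot = n)
    (hC : Marks C s) :
    (firstLabel.run s').reg Reg.val = relabel lab (active lab \ C) 0 x := by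
  by_cases hx : x ∈ C <;> by_cases hx2 : 2 ≤ lab x <;>
    simp [firstLabel, relabel, h.order, h.pivot, h.one, h.two, h.mark, hC x, h.val, hp, hx, hx2]

lemma run_secondLabel_split (h : AtVertex G w d lab s x s') (hp : s.reg Reg.pivot = n)
    (hC : Marks C s) : (secondLabel.run s').reg Reg.val = relabel lab C 0 x := by
  by_cases hx : x ∈ C <;>
    simp [secondLabel, relabel, h.order, h.pivot, h.one, h.mark, hC x, h.val, hp, hx]

/-- The result of `build` at a node whose block begins with the cell `b`: the labellings of the
children are in the next two blocks, and `k` is the pivot or the number of vertices. -/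
structure Built (G : SimpleGraph (Fin n)) (w : Fin n → ℝ≥0) (d b k : ℕ) (lab₁ lab₂ : Fin n → ℕ)
    (s : State) : Prop extends Ambient G w d s where
  base : s.reg Reg.base = b + n + n
  first : ∀ x : Fin n, s.arr Arr.label (b + n + x) = lab₁ x
  second : ∀ x : Fin n, s.arr Arr.label (b + n + n + x) = lab₂ x
  pivot : s.arr Arr.pivot b = k

lemma AtVertex.of_frame {s₀ : State} {p : Code} (h : AtVertex G w d lab s₀ x s')
    (hs : p.Frame s s₀) (hp : p.Avoids [.reg Reg.pivot, .reg Reg.newLabel, .arr Arr.mark]) :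
    AtVertex G w d lab s x s' :=
  { h with
    pivot := h.pivot.trans (hs.reg _ (hp _ (by decide)))
    newLabel := h.newLabel.trans (hs.reg _ (hp _ (by decide)))
    mark := by rw [h.mark, hs.arr _ (hp _ (by decide))]
    edge_iff := fun v hv => h.edge_iff v ((hs.reg _ (hp _ (by decide))).trans hv) }

lemma run_buildFirst {lab₁ : Fin n → ℕ} (h : AtNode G w d lab s)
    (h₁ : ∀ x s', AtVertex G w d lab s x s' → (firstLabel.run s').reg Reg.val = lab₁ x) :
    AtNode G w d lab (buildFirst.run s) ∧
      (buildFirst.run s).reg Reg.child = s.reg Reg.base + n ∧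
      (∀ x : Fin n, (buildFirst.run s).arr Arr.label (s.reg Reg.base + n + x) = lab₁ x) ∧
      (buildFirst.run s).arr Arr.pivot (s.reg Reg.base) = s.reg Reg.pivot ∧
      SameBelow (s.reg Reg.base) s (buildFirst.run s) := by
  set p : Code := Instr.store Arr.pivot Reg.base Reg.pivot ;; Instr.add Reg.child Reg.base Reg.order
  have hf := frame_run p s
  have hf' := frame_run (fillChild firstLabel) (p.run s)
  have hchild : (p.run s).reg Reg.child = s.reg Reg.base + n := by simp [p, h.order]
  have hpivot : (p.run s).arr Arr.pivot =
      Function.update (s.arr Arr.pivot) (s.reg Reg.base) (s.reg Reg.pivot) := by simp [p]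
  obtain ⟨hfirst, hlow⟩ := run_fillChild (h.run (p := p) (by decide))
    (by rw [hchild, hf.reg _ (by decide)]) (by decide) (by decide) (by decide)
    fun x s' hs' => h₁ x s' (hs'.of_frame hf (by decide))
  rw [hchild] at hfirst hlow
  rw [← hf'.arr Arr.pivot (by decide)] at hpivot
  rw [hf.arr Arr.label (by decide)] at hlow
  refine ⟨⟨h.toAmbient.run (by decide), fun x => ?_⟩, (hf'.reg _ (by decide)).trans hchild, hfirst,
    (congrFun hpivot _).trans (Function.update_self ..), fun c hc => hlow c (by omega), ?_,
    fun c hc => (congrFun hpivot c).trans (Function.update_of_ne hc.ne ..), ?_⟩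
  · rw [(frame_run buildFirst s).reg _ (by decide), ← h.label x]
    exact hlow _ (by omega)
  · exact fun c _ => by rw [(frame_run buildFirst s).arr _ (by decide)]
  · exact fun c _ => by rw [(frame_run buildFirst s).warr _ (by decide)]

lemma run_buildSecond {lab₂ : Fin n → ℕ} (h : AtNode G w d lab s)
    (hchild : s.reg Reg.child = s.reg Reg.base + n)
    (h₂ : ∀ x s', AtVertex G w d lab s x s' → (secondLabel.run s').reg Reg.val = lab₂ x) :
    (buildSecond.run s).reg Reg.base = s.reg Reg.base + n + n ∧
      (∀ x : Fin n, (buildSecond.run s).arr Arr.label (s.reg Reg.base + n + n + x) = lab₂ x) ∧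
      ∀ c < s.reg Reg.base + n + n,
        (buildSecond.run s).arr Arr.label c = s.arr Arr.label c := by
  set p : Code := Code.instr (Instr.add Reg.child Reg.child Reg.order)
  have hf := frame_run p s
  have hchild' : (p.run s).reg Reg.child = s.reg Reg.base + n + n := by simp [p, hchild, h.order]
  obtain ⟨hsecond, hlow⟩ := run_fillChild (h.run (p := p) (by decide))
    (by rw [hchild', hf.reg _ (by decide)]; omega) (by decide) (by decide) (by decide)
    fun x s' hs' => h₂ x s' (hs'.of_frame hf (by decide))
  rw [hchild'] at hsecond hlow
  exact ⟨((frame_run (fillChild secondLabel) (p.run s)).reg _ (by decide)).trans hchild',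
    hsecond, hlow⟩

lemma run_build {lab₁ lab₂ : Fin n → ℕ} (h : AtNode G w d lab s)
    (h₁ : ∀ x s', AtVertex G w d lab s x s' → (firstLabel.run s').reg Reg.val = lab₁ x)
    (h₂ : ∀ x s', AtVertex G w d lab s x s' → (secondLabel.run s').reg Reg.val = lab₂ x) :
    Built G w d (s.reg Reg.base) (s.reg Reg.pivot) lab₁ lab₂ (build.run s) ∧
      SameBelow (s.reg Reg.base) s (build.run s) := by
  have hf := frame_run buildFirst s
  have hf' := frame_run buildSecond (buildFirst.run s)
  have hb : (buildFirst.run s).reg Reg.base = s.reg Reg.base := hf.reg _ (by decide)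
  obtain ⟨hat, hchild, hfirst, hpivot, hsame⟩ := run_buildFirst h h₁
  obtain ⟨hbase, hsecond, hlow⟩ := run_buildSecond hat (by rw [hchild, hb])
    fun x s' hs' => h₂ x s' (hs'.of_frame hf (by decide))
  rw [hb] at hbase hsecond hlow
  rw [← hf'.arr Arr.pivot (by decide)] at hpivot
  refine ⟨⟨h.toAmbient.run (by decide), hbase, fun x => (hlow _ (by omega)).trans (hfirst x),
    hsecond, hpivot⟩, hsame.trans ⟨fun c hc => hlow c (by omega), ?_, ?_, ?_⟩⟩
  · exact fun c _ => congrFun (hf'.arr _ (by decide)) c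
  · exact fun c _ => congrFun (hf'.arr _ (by decide)) c
  · exact fun c _ => congrFun (hf'.warr _ (by decide)) c

end Build

section Results

variable {n d b k : ℕ} {G : SimpleGraph (Fin n)} {w : Fin n → ℝ≥0}
  {S S' S₁ : Finset (Fin n)} {v x : Fin n} {s s' : State}

open Code

section Save

/-- The set `S` and its weight are kept on the stacks, from the cell `b` on. -/
structure Saved (w : Fin n → ℝ≥0) (b : ℕ) (S : Finset (Fin n)) (s : State) : Prop where
  indicator : ∀ x : Fin n, s.arr Arr.saved (b + x) = if x ∈ S then 1 else 0
  weight : s.warr WArr.saved b = ∑ x ∈ S, w x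

/-- The set `S'` consists of `S` and the vertex `k`, which is not in `S`; here `k = n` stands for no
vertex. -/
structure IsExtension (w : Fin n → ℝ≥0) (k : ℕ) (S S' : Finset (Fin n)) : Prop where
  mem_iff : ∀ x : Fin n, x ∈ S' ↔ x = k ∨ x ∈ S
  sum_eq : ∑ x ∈ S', w x = ∑ x ∈ S, w x + if hk : k < n then w ⟨k, hk⟩ else 0

lemma isExtension_insert (hv : v ∉ S) : IsExtension w v S (insert v S) :=
  ⟨fun x => by simp [Fin.ext_iff], by simp [sum_insert hv, add_comm]⟩

lemma isExtension_self : IsExtension w n S S :=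
  ⟨fun x => by simp [x.2.ne], by simp⟩

def loadPivot : Code :=
  Instr.sub Reg.base Reg.base Reg.order ;; Instr.sub Reg.base Reg.base Reg.order ;;
    Instr.load Reg.pivot Arr.pivot Reg.base

def saveSet : Code :=
  fill Arr.saved Reg.i (Instr.load Reg.val Arr.out Reg.i ;;
    ifAll (Instr.const Reg.val 1) skip [.eq Reg.i Reg.pivot] ;; Instr.add Reg.addr Reg.base Reg.i)

def saveWeight : Code :=
  Instr.wmove WReg.tmp WReg.result ;;
    ifAll (Instr.wload WReg.saved WArr.weight Reg.pivot ;;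
      Instr.wadd WReg.tmp WReg.tmp WReg.saved) skip [.lt Reg.pivot Reg.order] ;;
    Instr.wstore WArr.saved Reg.base WReg.tmp

def saveResult : Code := saveSet ;; saveWeight

lemma isOutput_of_frame {p : Code} (h : IsOutput w S s) (hs : p.Frame s s')
    (hp : p.Avoids [.arr Arr.out, .wreg WReg.result]) : IsOutput w S s' :=
  ⟨fun x => by rw [hs.arr _ (hp _ (by decide)), h.1], by rw [hs.wreg _ (hp _ (by decide)), h.2]⟩

/-- Saves the result of the second child, together with the pivot, and passes to the first child. -/
def save : Code := loadPivot ;; saveResult ;; Instr.add Reg.base Reg.base Reg.order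

attribute [local simp] Code.run Instr.apply Test.Holds run_ifAll

lemma run_saveSet (h : Ambient G w d s) (hS : IsOutput w S s)
    (hS' : IsExtension w (s.reg Reg.pivot) S S') :
    (∀ x : Fin n, (saveSet.run s).arr Arr.saved (s.reg Reg.base + x) = if x ∈ S' then 1 else 0) ∧
      ∀ c < s.reg Reg.base, (saveSet.run s).arr Arr.saved c = s.arr Arr.saved c := by
  refine (run_fill (by decide) (by decide) h.order h.one fun x s' hs hx _ => ?_).imp_right
    fun hlow c hc => hlow c (.inl hc)
  have hbase := hs.reg Reg.base (by decide)
  have hpivot := hs.reg Reg.pivot (by decide)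
  have hout := congrFun (hs.arr Arr.out (by decide)) x
  by_cases hxp : x = s.reg Reg.pivot <;> simp [hx, hbase, hpivot, hout, hS.1, hS'.mem_iff, hxp]

lemma run_saveWeight (h : Ambient G w d s) (hS : IsOutput w S s)
    (hS' : IsExtension w (s.reg Reg.pivot) S S') :
    (saveWeight.run s).warr WArr.saved =
      Function.update (s.warr WArr.saved) (s.reg Reg.base) (∑ x ∈ S', w x) := by
  by_cases hp : s.reg Reg.pivot < n
  · simp [saveWeight, h.order, hp, hS'.sum_eq, hS.2, h.weight ⟨_, hp⟩]
  · simp [saveWeight, h.order, hp, hS'.sum_eq, hS.2]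

lemma run_saveResult (h : Ambient G w d s) (hb : s.reg Reg.base = b) (hk : s.reg Reg.pivot = k)
    (hS : IsOutput w S s) (hS' : IsExtension w k S S') :
    Saved w b S' (saveResult.run s) ∧ SameBelow b s (saveResult.run s) := by
  subst hb hk
  have hf := frame_run saveSet s
  have hf' := frame_run saveResult s
  obtain ⟨hset, hlow⟩ := run_saveSet h hS hS'
  have hweight : (saveResult.run s).warr WArr.saved =
      Function.update (s.warr WArr.saved) (s.reg Reg.base) (∑ x ∈ S', w x) := by
    have := run_saveWeight (S' := S') (h.run (p := saveSet) (by decide))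
      (isOutput_of_frame hS hf (by decide)) (by rwa [hf.reg _ (by decide)])
    rwa [hf.reg _ (by decide), hf.warr _ (by decide)] at this
  have hsaved : (saveResult.run s).arr Arr.saved = (saveSet.run s).arr Arr.saved :=
    (frame_run saveWeight _).arr _ (by decide)
  rw [← hsaved] at hset hlow
  exact ⟨⟨hset, by rw [hweight, Function.update_self]⟩,
    fun c _ => by rw [hf'.arr _ (by decide)], hlow, fun c _ => by rw [hf'.arr _ (by decide)],
    fun c hc => by rw [hweight, Function.update_of_ne hc.ne]⟩

lemma run_save (h : Ambient G w d s) (hb : s.reg Reg.base = b + n + n)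
    (hk : s.arr Arr.pivot b = k) (hS : IsOutput w S s) (hS' : IsExtension w k S S') :
    (save.run s).reg Reg.base = b + n ∧ Saved w b S' (save.run s) ∧
      SameBelow b s (save.run s) := by
  have h₁ : Ambient G w d (loadPivot.run s) := h.run (by decide)
  have hb₁ : (loadPivot.run s).reg Reg.base = b := by simp [loadPivot, h.order, hb]
  have hk₁ : (loadPivot.run s).reg Reg.pivot = k := by simp [loadPivot, h.order, hb, hk]
  obtain ⟨hsaved, hbelow⟩ := run_saveResult h₁ hb₁ hk₁
    (isOutput_of_frame hS (frame_run loadPivot s) (by decide)) hS'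
  have hf := frame_run saveResult (loadPivot.run s)
  have hbase : (save.run s).reg Reg.base = (saveResult.run (loadPivot.run s)).reg Reg.base +
    (saveResult.run (loadPivot.run s)).reg Reg.order := rfl
  refine ⟨?_, ⟨hsaved.indicator, hsaved.weight⟩,
    ((sameBelow_run (p := loadPivot) (by decide) b s).trans hbelow).trans
      (sameBelow_run (p := Instr.add Reg.base Reg.base Reg.order) (by decide) b _)⟩
  rw [hbase, hf.reg _ (by decide), hf.reg _ (by decide), hb₁, h₁.order]

end Save

section Combine

def takeSaved : Code :=
  fill Arr.out Reg.i (Instr.add Reg.addr Reg.base Reg.i ;;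
    Instr.load Reg.val Arr.saved Reg.addr ;; Instr.move Reg.addr Reg.i) ;;
  Instr.wmove WReg.result WReg.saved

def addSaved : Code :=
  fill Arr.out Reg.i (Instr.add Reg.addr Reg.base Reg.i ;;
    Instr.load Reg.val Arr.saved Reg.addr ;; Instr.load Reg.mark Arr.out Reg.i ;;
    Instr.add Reg.val Reg.val Reg.mark ;; Instr.move Reg.addr Reg.i) ;;
  Instr.wadd WReg.result WReg.result WReg.saved

def loadSaved : Code :=
  Instr.sub Reg.base Reg.base Reg.order ;; Instr.load Reg.pivot Arr.pivot Reg.base ;;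
    Instr.wload WReg.saved WArr.saved Reg.base

/-- Combines the results of the two children: the better one is chosen if there is a pivot, and
otherwise they are united. -/
def combine : Code :=
  loadSaved ;; ifAll (ifAll takeSaved skip [.wlt WReg.result WReg.saved]) addSaved
    [.lt Reg.pivot Reg.order]

def outputEmpty : Code :=
  fill Arr.out Reg.i (Instr.move Reg.addr Reg.i ;; Instr.const Reg.val 0) ;;
    Instr.wzero WReg.result

attribute [local simp] Code.run Instr.apply Test.Holds

lemma Saved.of_frame {p : Code} (h : Saved w b S s) (hs : p.Frame s s')
    (hp : p.Avoids [.arr Arr.saved, .warr WArr.saved]) : Saved w b S s' :=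
  ⟨fun x => by rw [hs.arr _ (hp _ (by decide)), h.indicator],
    by rw [hs.warr _ (hp _ (by decide)), h.weight]⟩

lemma run_outputEmpty (h : Ambient G w d s) : IsOutput w ∅ (outputEmpty.run s) := by
  obtain ⟨hout, -⟩ := run_fill (s := s) (b := 0) (a := Arr.out) (i := Reg.i)
    (q := Instr.move Reg.addr Reg.i ;; Instr.const Reg.val 0) (f := fun _ : Fin n => 0)
    (by decide) (by decide) h.order h.one fun x s' _ hx _ => by simp [hx]
  exact ⟨fun x => by simpa [outputEmpty] using hout x, by simp [outputEmpty]⟩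

lemma run_takeSaved (h : Ambient G w d s) (hS : Saved w (s.reg Reg.base) S s)
    (hw : s.wreg WReg.saved = ∑ x ∈ S, w x) : IsOutput w S (takeSaved.run s) := by
  set p : Code := fill Arr.out Reg.i (Instr.add Reg.addr Reg.base Reg.i ;;
    Instr.load Reg.val Arr.saved Reg.addr ;; Instr.move Reg.addr Reg.i)
  have hout : (∀ x : Fin n, (p.run s).arr Arr.out (0 + x) = if x ∈ S then 1 else 0) ∧ _ :=
    run_fill (by decide) (by decide) h.order h.one fun x s' hs hx _ => by
      simp [hx, hs.reg Reg.base (by decide), hs.arr Arr.saved (by decide), hS.indicator x]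
  simp only [zero_add] at hout
  exact ⟨hout.1, ((frame_run p s).wreg _ (by decide)).trans hw⟩

lemma run_addSaved (h : Ambient G w d s) (hS₁ : IsOutput w S₁ s)
    (hS : Saved w (s.reg Reg.base) S s) (hw : s.wreg WReg.saved = ∑ x ∈ S, w x)
    (hdisj : Disjoint S₁ S) : IsOutput w (S₁ ∪ S) (addSaved.run s) := by
  set p : Code := fill Arr.out Reg.i (Instr.add Reg.addr Reg.base Reg.i ;;
    Instr.load Reg.val Arr.saved Reg.addr ;; Instr.load Reg.mark Arr.out Reg.i ;;
    Instr.add Reg.val Reg.val Reg.mark ;; Instr.move Reg.addr Reg.i)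
  have hout : (∀ x : Fin n, (p.run s).arr Arr.out (0 + x) = if x ∈ S₁ ∪ S then 1 else 0) ∧ _ :=
    run_fill (by decide) (by decide) h.order h.one fun x s' hs hx hread => by
      have hx₁ : s'.arr Arr.out x = if x ∈ S₁ then 1 else 0 :=
        (hread _ (.inr (by omega))).trans (hS₁.1 x)
      have hnot : x ∈ S₁ → x ∉ S := fun h₁ => disjoint_left.1 hdisj h₁
      by_cases hxS : x ∈ S₁ <;>
        simp_all [hs.reg Reg.base (by decide), hs.arr Arr.saved (by decide), hS.indicator x]
  simp only [zero_add] at hout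
  refine ⟨hout.1, ?_⟩
  have hf := frame_run p s
  change (p.run s).wreg WReg.result + (p.run s).wreg WReg.saved = _
  rw [hf.wreg _ (by decide), hf.wreg _ (by decide), hw, sum_union hdisj, ← hS₁.2]

lemma run_loadSaved (h : Ambient G w d s) (hb : s.reg Reg.base = b + n) (hS : Saved w b S s) :
    (loadSaved.run s).reg Reg.base = b ∧ (loadSaved.run s).reg Reg.pivot = s.arr Arr.pivot b ∧
      (loadSaved.run s).wreg WReg.saved = ∑ x ∈ S, w x ∧ Saved w b S (loadSaved.run s) := by
  refine ⟨by simp [loadSaved, h.order, hb], by simp [loadSaved, h.order, hb], ?_,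
    hS.of_frame (frame_run _ _) (by decide)⟩
  simp [loadSaved, h.order, hb, hS.weight]

lemma run_combine_pivot (h : Ambient G w d s) (hb : s.reg Reg.base = b + n)
    (hk : s.arr Arr.pivot b < n) (hS : Saved w b S s) (hS₁ : IsOutput w S₁ s) :
    IsOutput w (if ∑ x ∈ S₁, w x < ∑ x ∈ S, w x then S else S₁) (combine.run s) := by
  obtain ⟨hbase, hpivot, hweight, hS'⟩ := run_loadSaved h hb hS
  have h' : Ambient G w d (loadSaved.run s) := h.run (by decide)
  have hS₁' : IsOutput w S₁ (loadSaved.run s) := isOutput_of_frame hS₁ (frame_run _ _) (by decide)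
  have hlt : (loadSaved.run s).reg Reg.pivot < (loadSaved.run s).reg Reg.order := by
    rwa [hpivot, h'.order]
  rw [combine, run_seq, run_ifAll_lt, if_pos hlt, run_ifAll]
  simp only [List.mem_singleton, forall_eq, Test.Holds, hweight, show _ = _ from hS₁'.2]
  split_ifs
  · exact run_takeSaved h' (hbase ▸ hS') hweight
  · exact hS₁'

lemma run_combine_split (h : Ambient G w d s) (hb : s.reg Reg.base = b + n)
    (hk : s.arr Arr.pivot b = n) (hS : Saved w b S s) (hS₁ : IsOutput w S₁ s)
    (hdisj : Disjoint S₁ S) : IsOutput w (S₁ ∪ S) (combine.run s) := by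
  obtain ⟨hbase, hpivot, hweight, hS'⟩ := run_loadSaved h hb hS
  have h' : Ambient G w d (loadSaved.run s) := h.run (by decide)
  rw [combine, run_seq, run_ifAll_lt, if_neg (by rw [hpivot, h'.order, hk]; exact lt_irrefl n)]
  exact run_addSaved h' (isOutput_of_frame hS₁ (frame_run _ _) (by decide)) (hbase ▸ hS') hweight
    hdisj

lemma run_combine_base (h : Ambient G w d s) (hb : s.reg Reg.base = b + n) :
    (combine.run s).reg Reg.base = b := by
  rw [combine, run_seq, (frame_run (ifAll _ _ _) _).reg _ (by decide)]
  simp [loadSaved, h.order, hb]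

end Combine

end Results

section Solve

variable {n d b k : ℕ} {G : SimpleGraph (Fin n)} {w : Fin n → ℝ≥0} {lab lab₁ lab₂ : Fin n → ℕ}
  {A C S S' S₁ S₂ : Finset (Fin n)} {v x : Fin n} {s s' out : State} {p : Cmd}

open Code

def prepare : Code := select ;; build

/-- The two recursive calls at an inner node. -/
def children : Cmd :=
  .seq (.seq (.call 0) save.compile) (.seq (.call 0) combine.compile)

/-- The recursive procedure. -/
def solve : Cmd :=
  .seq findActive.compile (.branch (.lt Reg.witness Reg.order)
    (.seq prepare.compile children) outputEmpty.compile)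

/-- The cost of a node apart from the step from one child to the other. -/
def overhead (n : ℕ) : ℕ := findActive.cost n + prepare.cost n + outputEmpty.cost n + 2

/-- A bound for the number of steps per node of the recursion tree. -/
def stepCost (n : ℕ) : ℕ := overhead n + save.cost n + combine.cost n

/-- The state `out` presents an optimal subset `S` of `A`, and compared with the state `s` the
stacks are unchanged below `b`. -/
structure Solved (G : SimpleGraph (Fin n)) (w : Fin n → ℝ≥0) (d : ℕ) (A : Finset (Fin n)) (b : ℕ)
    (s out : State) (S : Finset (Fin n)) : Prop extends Ambient G w d out where
  base : out.reg Reg.base = b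
  same : SameBelow b s out
  optimal : IsOptimal G w A S
  output : IsOutput w S out

/-- Started in the state `s`, the command `p` solves the node with labelling `lab`, whose block
begins with the cell `b`, and even leaves over `r` of the steps it is entitled to. -/
def SolvesNode (G : SimpleGraph (Fin n)) (w : Fin n → ℝ≥0) (d : ℕ) (lab : Fin n → ℕ) (b : ℕ)
    (p : Cmd) (s : State) (r : ℕ) : Prop :=
  ∃ c T out S, RecTree G d lab c ∧ T + r ≤ stepCost n * c ∧ Exec [solve] p s T out ∧
    Solved G w d (active lab) b s out S

/-- The recursive calls on the labelling `lab` are correct. -/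
def CallsSolve (G : SimpleGraph (Fin n)) (w : Fin n → ℝ≥0) (d : ℕ) (lab : Fin n → ℕ) : Prop :=
  ∀ s, AtNode G w d lab s → SolvesNode G w d lab (s.reg Reg.base) (.call 0) s 0

/-- While the first child is treated, the pivot `k` and the set `S'` obtained from the second child
are kept on the stacks; the block of the node begins with the cell `b`. -/
structure Kept (G : SimpleGraph (Fin n)) (w : Fin n → ℝ≥0) (d b k : ℕ) (S' : Finset (Fin n))
    (s out : State) : Prop extends Ambient G w d out where
  base : out.reg Reg.base = b + n
  pivot : out.arr Arr.pivot b = k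
  same : SameBelow b s out
  saved : Saved w b S' out

lemma exec_secondChild (hb : Built G w d b k lab₁ lab₂ s) (hn : 0 < n)
    (hcall : CallsSolve G w d lab₂) {f : Finset (Fin n) → Finset (Fin n)}
    (hf : ∀ S, IsOptimal G w (active lab₂) S → IsExtension w k S (f S)) :
    ∃ c T S out, RecTree G d lab₂ c ∧ T ≤ stepCost n * c + save.cost n ∧
      Exec [solve] (.seq (.call 0) save.compile) s T out ∧ IsOptimal G w (active lab₂) S ∧
      AtNode G w d lab₁ out ∧ Kept G w d b k (f S) s out := by
  obtain ⟨c, T, out, S, hc, hT, hE, hS⟩ := hcall s ⟨hb.toAmbient, fun x => hb.base ▸ hb.second x⟩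
  rw [hb.base] at hS
  have hpivot : out.arr Arr.pivot b = k := (hS.same.pivot b (by omega)).trans hb.pivot
  obtain ⟨T', hT', hE'⟩ := exec_compile (p := save) [solve] (by decide) hS.one
  obtain ⟨hbase, hsaved, hsame⟩ := run_save hS.toAmbient hS.base hpivot hS.output (hf S hS.optimal)
  have hamb : Ambient G w d (save.run out) := hS.toAmbient.run (by decide)
  rw [hS.order] at hT'
  refine ⟨c, T + T', S, _, hc, by omega, .seq hE hE', hS.optimal, ⟨hamb, fun x => ?_⟩,
    ⟨hamb, hbase, ?_, (hS.same.mono (by omega)).trans hsame, hsaved⟩⟩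
  · rw [hbase, (frame_run save out).arr _ (by decide), hS.same.label _ (by omega), hb.first]
  · rwa [(frame_run save out).arr _ (by decide)]

lemma exec_firstChild (h : AtNode G w d lab₁ s') (hk : Kept G w d b k S' s s') (hn : 0 < n)
    (hcall : CallsSolve G w d lab₁) :
    ∃ c T S out, RecTree G d lab₁ c ∧ T ≤ stepCost n * c ∧ Exec [solve] (.call 0) s' T out ∧
      IsOptimal G w (active lab₁) S ∧ IsOutput w S out ∧ Kept G w d b k S' s out := by
  obtain ⟨c, T, out, S, hc, hT, hE, hS⟩ := hcall s' h
  rw [hk.base] at hS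
  exact ⟨c, T, S, out, hc, hT, hE, hS.optimal, hS.output, hS.toAmbient, hS.base,
    (hS.same.pivot b (by omega)).trans hk.pivot, hk.same.trans (hS.same.mono (by omega)),
    fun x => (hS.same.saved _ (by omega)).trans (hk.saved.indicator x),
    (hS.same.weight b (by omega)).trans hk.saved.weight⟩

lemma exec_children (hb : Built G w d b k lab₁ lab₂ s) (hn : 0 < n)
    (h₁ : CallsSolve G w d lab₁) (h₂ : CallsSolve G w d lab₂) {f : Finset (Fin n) → Finset (Fin n)}
    (hf : ∀ S, IsOptimal G w (active lab₂) S → IsExtension w k S (f S)) :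
    ∃ c₁ c₂ T S₁ S₂ out, RecTree G d lab₁ c₁ ∧ RecTree G d lab₂ c₂ ∧
      T + overhead n ≤ stepCost n * (c₁ + c₂ + 1) ∧ Exec [solve] children s T (combine.run out) ∧
      IsOptimal G w (active lab₁) S₁ ∧ IsOptimal G w (active lab₂) S₂ ∧ IsOutput w S₁ out ∧
      Kept G w d b k (f S₂) s out := by
  obtain ⟨c₂, T₂, S₂, s', hc₂, hT₂, hE₂, hS₂, hat, hk⟩ := exec_secondChild hb hn h₂ hf
  obtain ⟨c₁, T₁, S₁, out, hc₁, hT₁, hE₁, hS₁, hout, hk'⟩ := exec_firstChild hat hk hn h₁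
  obtain ⟨T, hT, hE⟩ := exec_compile (p := combine) [solve] (by decide) hk'.one
  rw [hk'.order] at hT
  refine ⟨c₁, c₂, _, S₁, S₂, out, hc₁, hc₂, ?_, .seq hE₂ (.seq hE₁ hE), hS₁, hS₂, hout, hk'⟩
  rw [mul_add, mul_add, mul_one]
  nth_rw 3 [stepCost]
  omega

lemma Kept.solved (hk : Kept G w d b k S' s out) (hA : IsOptimal G w A S)
    (hS : IsOutput w S (combine.run out)) : Solved G w d A b s (combine.run out) S where
  toAmbient := hk.toAmbient.run (by decide)
  base := run_combine_base hk.toAmbient hk.base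
  same := hk.same.trans (sameBelow_run (by decide) _ _)
  optimal := hA
  output := hS

lemma solvesNode_children_pivot {lab' : Fin n → ℕ} {m : ℕ} (hp : IsPivot G d lab lab' v m)
    (hb : Built G w d b v (relabel lab' {v} m) (relabel lab' (closedNhd G (active lab) v) m) s)
    (h₁ : CallsSolve G w d (relabel lab' {v} m))
    (h₂ : CallsSolve G w d (relabel lab' (closedNhd G (active lab) v) m)) :
    SolvesNode G w d lab b children s (overhead n) := by
  obtain ⟨c₁, c₂, T, S₁, S₂, out, hc₁, hc₂, hT, hE, hS₁, hS₂, hout, hk⟩ :=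
    exec_children hb v.pos h₁ h₂ fun S hS => by
      rw [hp.active_relabel] at hS
      exact isExtension_insert (notMem_of_subset_sdiff_closedNhd hp.mem hS.subset)
  rw [hp.active_relabel] at hS₁ hS₂
  exact ⟨_, T, _, _, .branch hp hc₁ hc₂, hT, hE, hk.solved (isOptimal_pivot hp.mem hS₁ hS₂)
    (run_combine_pivot hk.toAmbient hk.base (hk.pivot ▸ v.2) hk.saved hout)⟩

lemma solvesNode_children_split (hC : IsSplit G d lab C)
    (hb : Built G w d b n (relabel lab (active lab \ C) 0) (relabel lab C 0) s)
    (h₁ : CallsSolve G w d (relabel lab (active lab \ C) 0))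
    (h₂ : CallsSolve G w d (relabel lab C 0)) :
    SolvesNode G w d lab b children s (overhead n) := by
  obtain ⟨v, -⟩ := hC.isUnion.nonempty
  obtain ⟨c₁, c₂, T, S₁, S₂, out, hc₁, hc₂, hT, hE, hS₁, hS₂, hout, hk⟩ :=
    exec_children hb v.pos h₁ h₂ (f := id) fun S _ => isExtension_self
  rw [active_relabel (by decide)] at hS₁ hS₂
  obtain ⟨hdisj, hS⟩ := isOptimal_split hC.isUnion hS₁ hS₂
  exact ⟨_, T, _, _, .split hC hc₁ hc₂, hT, hE, hk.solved hS
    (run_combine_split hk.toAmbient hk.base hk.pivot hk.saved hout hdisj)⟩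

lemma solvesNode_seq {q : Code} {r : ℕ} (h : Ambient G w d s) (hq : q.WellFormed)
    (hsame : SameBelow b s (q.run s)) (hp : SolvesNode G w d lab b p (q.run s) (q.cost n + r)) :
    SolvesNode G w d lab b (.seq q.compile p) s r := by
  obtain ⟨c, T, out, S, hc, hT, hE, hS⟩ := hp
  obtain ⟨T', hT', hE'⟩ := exec_compile [solve] hq h.one
  rw [h.order] at hT'
  exact ⟨c, T' + T, out, S, hc, by omega, .seq hE' hE,
    { hS with same := hsame.trans hS.same }⟩

lemma solvesNode_prepare (h : AtNode G w d lab s) (hv : v ∈ active lab)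
    (hw : s.reg Reg.witness = v) (ih : ∀ lab', active lab' ⊂ active lab → CallsSolve G w d lab') :
    SolvesNode G w d lab (s.reg Reg.base) (.seq prepare.compile children) s
      (findActive.cost n + outputEmpty.cost n + 2) := by
  obtain ⟨hsel, hsame⟩ := run_select h hv hw
  have hb : (select.run s).reg Reg.base = s.reg Reg.base :=
    (frame_run select s).reg _ (by decide)
  have hcost : prepare.cost n + (findActive.cost n + outputEmpty.cost n + 2) = overhead n := by
    rw [overhead]
    omega
  suffices SolvesNode G w d lab (s.reg Reg.base) children (prepare.run s) (overhead n) ∧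
      SameBelow (s.reg Reg.base) (select.run s) (prepare.run s) by
    exact solvesNode_seq h.toAmbient (by decide) (hsame.trans this.2) (hcost ▸ this.1)
  rw [← hb, prepare, run_seq]
  cases hsel with
  | pivot h' hv hp =>
    obtain ⟨hbuilt, hbelow⟩ := run_build h' (fun x s' hx => run_firstLabel_pivot hx hv)
      fun x s' hx => run_secondLabel_pivot hx hv (hp.active_eq ▸ hp.mem)
    rw [hv, hp.active_eq] at hbuilt
    refine ⟨solvesNode_children_pivot hp hbuilt (ih _ ?_) (ih _ ?_), hbelow⟩
    · rw [hp.active_relabel]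
      exact sdiff_ssubset (singleton_subset_iff.2 hp.mem) (singleton_nonempty _)
    · rw [hp.active_relabel]
      exact sdiff_ssubset closedNhd_subset ⟨_, self_mem_closedNhd hp.mem⟩
  | split h' hr hC hsplit =>
    obtain ⟨hbuilt, hbelow⟩ := run_build h' (fun x s' hx => run_firstLabel_split hx hr hC)
      fun x s' hx => run_secondLabel_split hx hr hC
    refine ⟨solvesNode_children_split hsplit (hr ▸ hbuilt) (ih _ ?_) (ih _ ?_), hbelow⟩
    · rw [active_relabel (by decide)]
      exact sdiff_ssubset sdiff_subset (sdiff_nonempty.2 fun hsub =>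
        hsplit.ne (hsplit.isUnion.subset.antisymm hsub))
    · rw [active_relabel (by decide)]
      exact sdiff_ssubset hsplit.isUnion.subset hsplit.isUnion.nonempty

lemma solvesNode_outputEmpty (h : AtNode G w d lab s) (hA : active lab = ∅) :
    SolvesNode G w d lab (s.reg Reg.base) outputEmpty.compile s (findActive.cost n + 2) := by
  obtain ⟨T, hT, hE⟩ := exec_compile (p := outputEmpty) [solve] (by decide) h.one
  rw [h.order] at hT
  refine ⟨1, T, _, ∅, .leaf hA, ?_, hE, h.toAmbient.run (by decide),
    (frame_run outputEmpty s).reg _ (by decide), sameBelow_run (by decide) _ _,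
    by rw [hA]; exact isOptimal_empty, run_outputEmpty h.toAmbient⟩
  rw [stepCost, overhead]
  omega

lemma callsSolve (G : SimpleGraph (Fin n)) (w : Fin n → ℝ≥0) (d : ℕ) (lab : Fin n → ℕ) :
    CallsSolve G w d lab := by
  induction hA : active lab using Finset.strongInduction generalizing lab with
  | _ A ih =>
    subst hA
    intro s h
    have h' : AtNode G w d lab (findActive.run s) := h.run (by decide)
    have hb : (findActive.run s).reg Reg.base = s.reg Reg.base :=
      (frame_run findActive s).reg _ (by decide)
    have hsame := sameBelow_run (p := findActive) (by decide) (s.reg Reg.base) s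
    suffices SolvesNode G w d lab (s.reg Reg.base) (.branch (.lt Reg.witness Reg.order)
        (.seq prepare.compile children) outputEmpty.compile) (findActive.run s)
        (findActive.cost n + 1) by
      obtain ⟨c, T, out, S, hc, hT, hE, hS⟩ :=
        solvesNode_seq h.toAmbient (by decide) hsame this
      exact ⟨c, T + 1, out, S, hc, hT, .call rfl hE, hS⟩
    rw [← hb]
    obtain ⟨hw, hnone⟩ | ⟨v, hw, hv⟩ := run_findActive h
    · obtain ⟨c, T, out, S, hc, hT, hE, hS⟩ :=
        solvesNode_outputEmpty h' (eq_empty_of_forall_notMem hnone)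
      exact ⟨c, T + 1, out, S, hc, by omega, .branch_false (by simp [Test.Holds, hw, h'.order]) hE,
        hS⟩
    · obtain ⟨c, T, out, S, hc, hT, hE, hS⟩ :=
        solvesNode_prepare h' hv hw fun lab' hlab' => ih _ hlab' lab' rfl
      exact ⟨c, T + 1, out, S, hc, by omega, .branch_true (by simp [Test.Holds, hw, h'.order]) hE,
        hS⟩

end Solve

section Main

variable {n : ℕ} {G : SimpleGraph (Fin n)} {w : Fin n → ℝ≥0}

section Setup

open Code

variable {t : ℕ} {s : State}

def initRows : Code :=
  Instr.const Reg.two 2 ;; Instr.const Reg.three 3 ;; Instr.const Reg.addr 0 ;;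
  .rep Reg.i (Instr.store Arr.row Reg.i Reg.addr ;; Instr.add Reg.addr Reg.addr Reg.order ;;
    Instr.store Arr.label Reg.i Reg.two)

/-- Writes `n * n.size` into the register `target`. -/
def initTarget : Code :=
  Instr.const Reg.power 1 ;; Instr.const Reg.target 0 ;;
  .rep Reg.i (.branch (.le Reg.power Reg.order)
    (Instr.add Reg.power Reg.power Reg.power ;; Instr.add Reg.target Reg.target Reg.order) .skip)

/-- Passes from the degree bound `d` to `d + 1`, from the content `t * d ^ 2` of the register
`square` to `t * (d + 1) ^ 2`, and from the difference `t * (2 * d + 1)` in the register `increment`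
to the next one. -/
def nextSquare : Code :=
  Instr.add Reg.square Reg.square Reg.increment ;;
  Instr.add Reg.increment Reg.increment Reg.twicePathOrder ;;
  Instr.add Reg.degBound Reg.degBound Reg.one

def initDegBound : Code :=
  Instr.const Reg.degBound 0 ;; Instr.const Reg.square 0 ;;
  Instr.move Reg.increment Reg.pathOrder ;;
  Instr.add Reg.twicePathOrder Reg.pathOrder Reg.pathOrder ;;
  .rep Reg.i (.branch (.lt Reg.square Reg.target) nextSquare .skip)

def setup : Code := initRows ;; initTarget ;; initDegBound

lemma run_initRows (h0 : s.reg Reg.order = n) (h1 : s.reg Reg.one = 1) :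
    (initRows.run s).reg Reg.two = 2 ∧ (initRows.run s).reg Reg.three = 3 ∧ ∀ x : Fin n,
      (initRows.run s).arr Arr.row x = n * x ∧ (initRows.run s).arr Arr.label x = 2 := by
  suffices (initRows.run s).reg Reg.two = 2 ∧ (initRows.run s).reg Reg.three = 3 ∧
      (initRows.run s).reg Reg.addr = n * n ∧ ∀ x : Fin n, (x : ℕ) < n →
      (initRows.run s).arr Arr.row x = n * x ∧ (initRows.run s).arr Arr.label x = 2 from
    ⟨this.1, this.2.1, fun x => this.2.2.2 x x.2⟩
  refine run_rep_induction
    (s := (Instr.const Reg.two 2 ;; Instr.const Reg.three 3 ;; Instr.const Reg.addr 0 : Code).run s)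
    (by decide) h0 h1 (fun k s' => s'.reg Reg.two = 2 ∧ s'.reg Reg.three = 3 ∧
      s'.reg Reg.addr = n * k ∧ ∀ x : Fin n, (x : ℕ) < k →
        s'.arr Arr.row x = n * x ∧ s'.arr Arr.label x = 2) (by simp [run, Instr.apply]) ?_
  rintro v s' hv hf ⟨h2, h3, haddr, htab⟩
  have h0' : s'.reg Reg.order = n := (hf.reg _ (by decide)).trans h0
  refine ⟨by simpa [next, run, Instr.apply] using h2, by simpa [next, run, Instr.apply] using h3,
    by simp_all [next, run, Instr.apply, mul_add], fun x hx => ?_⟩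
  obtain rfl | hxv := eq_or_ne x v
  · simp_all [next, run, Instr.apply]
  · have hxv' : (x : ℕ) ≠ v := Fin.val_ne_of_ne hxv
    simpa [next, run, Instr.apply, hv, Function.update_of_ne hxv'] using htab x (by omega)

lemma size_le_self (n : ℕ) : n.size ≤ n := Nat.size_le.2 Nat.lt_two_pow_self

lemma run_initTarget (h0 : s.reg Reg.order = n) (h1 : s.reg Reg.one = 1) :
    (initTarget.run s).reg Reg.target = n * n.size := by
  suffices (initTarget.run s).reg Reg.power = 2 ^ min n n.size ∧
      (initTarget.run s).reg Reg.target = n * min n n.size by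
    rw [this.2, min_eq_right (size_le_self n)]
  refine run_rep_induction
    (s := (Instr.const Reg.power 1 ;; Instr.const Reg.target 0 : Code).run s) (by decide) h0 h1
    (fun k s' => s'.reg Reg.power = 2 ^ min k n.size ∧ s'.reg Reg.target = n * min k n.size)
    (by simp [run, Instr.apply]) ?_
  rintro v s' - hf ⟨hpow, htar⟩
  have h0' : s'.reg Reg.order = n := (hf.reg _ (by decide)).trans h0
  have hle : 2 ^ min (v : ℕ) n.size ≤ n ↔ (v : ℕ) < n.size := by
    rw [← Nat.lt_size]
    omega
  by_cases hlt : (v : ℕ) < n.size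
  · have hmin : min ((v : ℕ) + 1) n.size = min (v : ℕ) n.size + 1 := by omega
    rw [hmin]
    simp [next, run, Instr.apply, Test.Holds, hpow, htar, h0', hle, hlt, pow_succ, mul_two, mul_add]
  · have hmin : min ((v : ℕ) + 1) n.size = min (v : ℕ) n.size := by omega
    rw [hmin]
    simp [next, run, Instr.apply, Test.Holds, hpow, htar, h0', hle, hlt]

/-- `d` is the least number with `t * d ^ 2 ≥ n * n.size`, the degree from which on the algorithm
branches on a vertex; `n.size` is the number of binary digits of `n`, in place of `log n`. -/
def IsThreshold (t n d : ℕ) : Prop := IsLeast {d | n * n.size ≤ t * d ^ 2} d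

lemma mul_size_le (ht : 0 < t) (n : ℕ) : n * n.size ≤ t * n ^ 2 :=
  calc n * n.size ≤ n * n := Nat.mul_le_mul_left n (size_le_self n)
    _ ≤ t * n ^ 2 := by nlinarith

lemma IsThreshold.le {d : ℕ} (hd : IsThreshold t n d) (ht : 0 < t) : d ≤ n :=
  hd.2 (mul_size_le ht n)

lemma IsThreshold.pos {d : ℕ} (hd : IsThreshold t n d) (hn : 0 < n) : 0 < d := by
  refine Nat.pos_of_ne_zero ?_
  rintro rfl
  have h : n * n.size ≤ t * 0 ^ 2 := hd.1
  have := Nat.mul_pos hn (Nat.size_pos.2 hn)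
  omega

/-- The invariant of the loop of `initDegBound` after `k` rounds. -/
structure Squares (t n k : ℕ) (s : State) : Prop where
  square : s.reg Reg.square = t * s.reg Reg.degBound ^ 2
  increment : s.reg Reg.increment = t * (2 * s.reg Reg.degBound + 1)
  le_or_eq : n * n.size ≤ t * s.reg Reg.degBound ^ 2 ∨ s.reg Reg.degBound = k
  lt : ∀ e < s.reg Reg.degBound, t * e ^ 2 < n * n.size

lemma Squares.isThreshold (h : Squares t n n s) (ht : 0 < t) :
    IsThreshold t n (s.reg Reg.degBound) :=
  ⟨h.le_or_eq.elim id fun hd => hd ▸ mul_size_le ht n,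
    fun e he => not_lt.1 fun hlt => (h.lt e hlt).not_ge he⟩

lemma Squares.run_nextSquare {k : ℕ} (h : Squares t n k s) (h1 : s.reg Reg.one = 1)
    (htwice : s.reg Reg.twicePathOrder = t + t)
    (hlt : t * s.reg Reg.degBound ^ 2 < n * n.size) : Squares t n (k + 1) (nextSquare.run s) := by
  have hd : (nextSquare.run s).reg Reg.degBound = s.reg Reg.degBound + 1 := congrArg _ h1
  have hsq : (nextSquare.run s).reg Reg.square = s.reg Reg.square + s.reg Reg.increment := rfl
  have hinc : (nextSquare.run s).reg Reg.increment = s.reg Reg.increment + (t + t) :=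
    congrArg _ htwice
  refine ⟨?_, ?_, .inr (hd.trans (by rw [h.le_or_eq.resolve_left hlt.not_ge])), fun e he => ?_⟩
  · rw [hsq, hd, h.square, h.increment]
    ring
  · rw [hinc, hd, h.increment]
    ring
  · rw [hd, Nat.lt_succ_iff] at he
    calc t * e ^ 2 ≤ t * s.reg Reg.degBound ^ 2 := by gcongr
      _ < n * n.size := hlt

lemma Squares.next {f : State → State} {k : ℕ} (h : Squares t n k (f s)) :
    Squares t n k (next Reg.i f s) :=
  ⟨h.square, h.increment, h.le_or_eq, h.lt⟩

lemma run_initDegBound (h0 : s.reg Reg.order = n) (h1 : s.reg Reg.one = 1)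
    (ht : s.reg Reg.pathOrder = t) (htar : s.reg Reg.target = n * n.size) :
    Squares t n n (initDegBound.run s) := by
  set p : Code := Instr.const Reg.degBound 0 ;; Instr.const Reg.square 0 ;;
    Instr.move Reg.increment Reg.pathOrder ;;
    Instr.add Reg.twicePathOrder Reg.pathOrder Reg.pathOrder with hp
  refine run_rep_induction (s := p.run s) (by decide) h0 h1 (Squares t n)
    (by constructor <;> simp [hp, run, Instr.apply, ht]) fun v s' _ hf hI => .next ?_
  have htwice : s'.reg Reg.twicePathOrder = t + t := by
    rw [hf.reg _ (by decide)]
    simp [hp, run, Instr.apply, ht]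
  have htest : (Test.lt Reg.square Reg.target).Holds s' ↔
      t * s'.reg Reg.degBound ^ 2 < n * n.size := by
    rw [Test.Holds, hI.square, (hf.reg Reg.target (by decide)).trans htar]
  by_cases hlt : t * s'.reg Reg.degBound ^ 2 < n * n.size
  · rw [run_branch_of (htest.2 hlt)]
    exact hI.run_nextSquare ((hf.reg _ (by decide)).trans h1) htwice hlt
  · rw [run_branch_of_not (mt htest.1 hlt)]
    exact ⟨hI.square, hI.increment, .inl (not_lt.1 hlt), hI.lt⟩

end Setup

section Program

open Code

variable {t : ℕ}

lemma adj_inputState (t : ℕ) (G : SimpleGraph (Fin n)) (w : Fin n → ℝ≥0) (x y : Fin n) :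
    open Classical in
    (inputState t G w).arr Arr.adj (n * x + y) = if G.Adj x y then 1 else 0 := by
  classical
  refine if_congr ⟨?_, fun h => ⟨rfl, x, y, h, rfl⟩⟩ rfl rfl
  rintro ⟨-, i, j, hij, h⟩
  have hdiv : (x : ℕ) = i := by
    simpa [Nat.mul_add_div x.pos, Nat.div_eq_of_lt] using congrArg (· / n) h
  have hmod : (y : ℕ) = j := by simpa [Nat.mul_add_mod, Nat.mod_eq_of_lt] using congrArg (· % n) h
  rwa [Fin.ext hdiv, Fin.ext hmod]

/-- The initial state, once the constant one has been put into its register. -/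
noncomputable def startState (t : ℕ) (G : SimpleGraph (Fin n)) (w : Fin n → ℝ≥0) : State :=
  (Instr.const Reg.one 1).apply (inputState t G w)

lemma atNode_setup (ht : 0 < t) (G : SimpleGraph (Fin n)) (w : Fin n → ℝ≥0) :
    ∃ d, IsThreshold t n d ∧ AtNode G w d (fun _ => 2) (setup.run (startState t G w)) := by
  set s₀ := startState t G w
  have hbase : (setup.run s₀).reg Reg.base = 0 := (frame_run setup s₀).reg _ (by decide)
  obtain ⟨htwo, hthree, htab⟩ := run_initRows (n := n) (s := s₀) rfl rfl
  set s₁ := initRows.run s₀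
  have hf : setup.Frame s₀ (setup.run s₀) := frame_run _ _
  have hf₁ : initRows.Frame s₀ s₁ := frame_run _ _
  have hf₁₂ : (initRows ;; initTarget).Frame s₀ (initTarget.run s₁) := frame_run _ _
  have hf₂₃ : (initTarget ;; initDegBound).Frame s₁ (setup.run s₀) := frame_run _ _
  have htar : (initTarget.run s₁).reg Reg.target = n * n.size :=
    run_initTarget (hf₁.reg _ (by decide)) (hf₁.reg _ (by decide))
  have hsq : Squares t n n (setup.run s₀) := run_initDegBound (hf₁₂.reg _ (by decide))
    (hf₁₂.reg _ (by decide)) (hf₁₂.reg _ (by decide)) htar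
  refine ⟨_, hsq.isThreshold ht, ⟨⟨?_, ?_, ?_, ?_, ?_, ?_, ?_, ?_, ?_⟩, ?_⟩⟩
  · exact hf.reg _ (by decide)
  · exact hf.reg _ (by decide)
  · exact (hf₂₃.reg _ (by decide)).trans htwo
  · exact (hf₂₃.reg _ (by decide)).trans hthree
  · exact hf.reg _ (by decide)
  · rfl
  · exact fun x y => (congrFun (hf.arr _ (by decide)) _).trans (adj_inputState t G w x y)
  · exact fun x => (congrFun (hf₂₃.arr _ (by decide)) _).trans (htab x).1
  · exact fun x => (congrFun (hf.warr _ (by decide)) _).trans (dif_pos ⟨rfl, x.2⟩)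
  · intro x
    rw [hbase, zero_add, hf₂₃.arr _ (by decide), (htab x).2]

def program : Program where
  main := .seq (.instr (.const Reg.one 1)) (.seq setup.compile (.call 0))
  procs := [solve]

lemma exec_program (ht : 0 < t) (G : SimpleGraph (Fin n)) (w : Fin n → ℝ≥0) :
    ∃ d c T s S, IsThreshold t n d ∧ RecTree G d (fun _ => 2) c ∧
      T ≤ setup.cost n + 1 + stepCost n * c ∧
      Exec program.procs program.main (inputState t G w) T s ∧
      IsMaxWeightIndepSet G w S ∧ IsOutput w S s := by
  obtain ⟨d, hd, hat⟩ := atNode_setup ht G w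
  obtain ⟨T₀, hT₀, hE₀⟩ :=
    exec_compile [solve] (p := setup) (s := startState t G w) (by decide) rfl
  obtain ⟨c, T, s, S, hc, hT, hE, hS⟩ := callsSolve G w d _ _ hat
  refine ⟨d, c, 1 + (T₀ + T), s, S, hd, hc, ?_, .seq (.instr _ _) (.seq hE₀ hE),
    ⟨hS.optimal.isIndepSet, fun S' hS' => hS.optimal.le S' (fun x _ => by simp [active]) hS'⟩,
    hS.output⟩
  have h0 : (startState t G w).reg Reg.order = n := rfl
  rw [h0] at hT₀
  omega

end Program

end Main

/-! ### The running time -/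

section Time

variable {n : ℕ} {G : SimpleGraph (Fin n)} {w : Fin n → ℝ≥0}

section Estimates

variable {t d c : ℕ}

lemma exp_le_two_rpow {x : ℝ} (hx : 0 ≤ x) : Real.exp x ≤ 2 ^ (2 * x) := by
  calc Real.exp x = Real.exp 1 ^ x := (Real.exp_one_rpow x).symm
    _ ≤ (2 ^ (2 : ℝ)) ^ x := by
      gcongr
      linarith [Real.exp_one_lt_d9, Real.rpow_two (2 : ℝ)]
    _ = 2 ^ (2 * x) := (Real.rpow_mul zero_le_two _ _).symm

lemma one_add_div_pow_add_one_le {L : ℕ} (hd : 0 < d) (hL : d < 2 ^ L) :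
    (1 + (L : ℝ) / d) ^ d + 1 ≤ (1 + (L : ℝ) / d) ^ (d + 1) := by
  have hL1 : (1 : ℝ) ≤ L := by
    have : L ≠ 0 := by
      rintro rfl
      omega
    exact_mod_cast Nat.one_le_iff_ne_zero.2 this
  set r : ℝ := L / d
  have hdr : d * r = L := mul_div_cancel₀ _ (by positivity)
  have hr0 : 0 < r := by positivity
  suffices 1 ≤ (1 + r) ^ d * r by linarith [pow_succ (1 + r) d]
  obtain hr1 | hr1 := le_total 1 r
  · exact one_le_mul_of_one_le_of_one_le (one_le_pow₀ (by linarith)) hr1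
  · have hconcave : (2 : ℝ) ^ r ≤ 1 + r := by
      simpa [one_add_one_eq_two] using
        rpow_one_add_le_one_add_mul_self (s := 1) (by norm_num) hr0.le hr1
    calc 1 ≤ d * r := hdr ▸ hL1
      _ ≤ 2 ^ L * r := by
        gcongr
        exact_mod_cast hL.le
      _ = (2 ^ r) ^ d * r := by
        rw [← Real.rpow_natCast (2 ^ r), ← Real.rpow_mul zero_le_two, mul_comm r, hdr,
          Real.rpow_natCast]
      _ ≤ (1 + r) ^ d * r := by gcongr

lemma pos_of_isPathFree (h : IsPathFree t G) : 0 < t := by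
  refine Nat.pos_of_ne_zero ?_
  rintro rfl
  exact h ⟨⟨⟨finZeroElim, fun i => i.elim0⟩, fun {i} => i.elim0⟩⟩

lemma RecTree.add_one_le (hfree : IsPathFree t G) (hd : IsThreshold t n d)
    (hc : RecTree G d (fun _ => 2) c) :
    (c : ℝ) + 1 ≤ 4 * (n + 1) * 2 ^ (min t n * d) * (1 + (n.size : ℝ) / d) ^ n := by
  have htrail : ∀ X k r, IsTrail G X k r → k < min t n := fun X k r h =>
    lt_min (h.lt_of_isPathFree hfree) (by simpa using h.lt_card)
  have hbase (hdn : d < Fintype.card (Fin n)) :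
      (1 + (n.size : ℝ) / d) ^ d + 1 ≤ (1 + (n.size : ℝ) / d) ^ (d + 1) := by
    rw [Fintype.card_fin] at hdn
    exact one_add_div_pow_add_one_le (hd.pos (by omega)) (hdn.trans n.lt_size_self)
  have := hc.le htrail (le_add_of_nonneg_right (by positivity)) hbase fun _ => .inr rfl
  simp only [active, le_refl, filter_true, card_univ, Fintype.card_fin] at this
  exact this.trans_eq (by ring)

lemma min_mul_threshold_le (hd : IsThreshold t n d) :
    ((min t n * d : ℕ) : ℝ) ≤ 2 * √((t : ℝ) * n * n.size) := by
  obtain rfl | hn := n.eq_zero_or_pos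
  · simp
  obtain ⟨e, rfl⟩ := Nat.exists_eq_add_one.2 (hd.pos hn)
  have hsize : (1 : ℝ) ≤ n.size := by exact_mod_cast Nat.size_pos.2 hn
  have hlt : t * e ^ 2 ≤ n * n.size :=
    (not_le.1 fun h => (hd.2 h).not_gt e.lt_succ_self).le
  have hpred : ((t * e : ℕ) : ℝ) ≤ √((t : ℝ) * n * n.size) := by
    refine Real.le_sqrt_of_sq_le ?_
    norm_cast
    calc (t * e) ^ 2 = t * (t * e ^ 2) := by ring
      _ ≤ t * (n * n.size) := Nat.mul_le_mul_left t hlt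
      _ = t * n * n.size := (mul_assoc _ _ _).symm
  have hmin : ((min t n : ℕ) : ℝ) ≤ √((t : ℝ) * n * n.size) := by
    refine Real.le_sqrt_of_sq_le ?_
    calc ((min t n : ℕ) : ℝ) ^ 2 = (min t n : ℕ) * (min t n : ℕ) := sq _
      _ ≤ t * n := by
        gcongr
        exacts [min_le_left t n, min_le_right t n]
      _ ≤ t * n * n.size := le_mul_of_one_le_right (by positivity) hsize
  calc ((min t n * (e + 1) : ℕ) : ℝ) = ((min t n * e : ℕ) : ℝ) + (min t n : ℕ) := by
        push_cast
        ring
    _ ≤ ((t * e : ℕ) : ℝ) + (min t n : ℕ) := by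
        gcongr
        exact min_le_left t n
    _ ≤ 2 * √((t : ℝ) * n * n.size) := by linarith

lemma one_add_div_pow_le (hd : IsThreshold t n d) :
    (1 + (n.size : ℝ) / d) ^ n ≤ 2 ^ (2 * √((t : ℝ) * n * n.size)) := by
  obtain rfl | hn := n.eq_zero_or_pos
  · simp
  have hd0 : (0 : ℝ) < d := by exact_mod_cast hd.pos hn
  have hle : (n : ℝ) * n.size ≤ t * d ^ 2 := by exact_mod_cast hd.1
  have hexp : (n : ℝ) * (n.size / d) ≤ √((t : ℝ) * n * n.size) := by
    refine Real.le_sqrt_of_sq_le ?_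
    calc ((n : ℝ) * (n.size / d)) ^ 2 = (n : ℝ) * n.size / (d : ℝ) ^ 2 * (n * n.size) := by ring
      _ ≤ (t : ℝ) * (n * n.size) := by
        gcongr
        exact (div_le_iff₀ (by positivity)).2 hle
      _ = (t : ℝ) * n * n.size := (mul_assoc _ _ _).symm
  calc (1 + (n.size : ℝ) / d) ^ n ≤ Real.exp (n.size / d) ^ n := by
        gcongr
        linarith [Real.add_one_le_exp ((n.size : ℝ) / d)]
    _ = Real.exp (n * (n.size / d)) := (Real.exp_nat_mul _ _).symm
    _ ≤ Real.exp (√((t : ℝ) * n * n.size)) := Real.exp_le_exp.2 hexp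
    _ ≤ 2 ^ (2 * √((t : ℝ) * n * n.size)) := exp_le_two_rpow (Real.sqrt_nonneg _)

lemma size_le_four_mul_log (hn : 2 ≤ n) : (n.size : ℝ) ≤ 4 * Real.log n := by
  have hn' : (2 : ℝ) ≤ n := by exact_mod_cast hn
  have hlog : Real.log 2 ≤ Real.log n := Real.log_le_log two_pos hn'
  obtain ⟨m, hm⟩ := Nat.exists_eq_add_one.2 (Nat.size_pos.2 (by omega : 0 < n))
  have hpow : (2 : ℝ) ^ m ≤ n := by exact_mod_cast Nat.lt_size.1 (by omega)
  have hmul : m * Real.log 2 ≤ Real.log n := by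
    simpa using Real.log_le_log (by positivity) hpow
  have := Real.log_two_gt_d9
  rw [hm]
  push_cast
  nlinarith

lemma sqrt_size_le (hn : 2 ≤ n) (t : ℕ) :
    √((t : ℝ) * n * n.size) ≤ 2 * √((t : ℝ) * n * Real.log n) := by
  calc √((t : ℝ) * n * n.size) ≤ √((t : ℝ) * n * (4 * Real.log n)) := by
        gcongr
        exact size_le_four_mul_log hn
    _ = √(2 ^ 2 * ((t : ℝ) * n * Real.log n)) := by ring_nf
    _ = 2 * √((t : ℝ) * n * Real.log n) := by
        rw [Real.sqrt_mul (by positivity), Real.sqrt_sq zero_le_two]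

lemma add_two_le (ht : 0 < t) (n : ℕ) :
    (n : ℝ) + 2 ≤ 3 * 2 ^ (2 * √((t : ℝ) * n * Real.log n)) := by
  obtain rfl | hn := n.eq_zero_or_pos
  · norm_num
  have hn' : (1 : ℝ) ≤ n := by exact_mod_cast hn
  have ht' : (1 : ℝ) ≤ t := by exact_mod_cast ht
  have hlog : Real.log n ≤ √((t : ℝ) * n * Real.log n) := by
    refine Real.le_sqrt_of_sq_le ?_
    have : 0 ≤ Real.log n := Real.log_nonneg hn'
    calc Real.log n ^ 2 = 1 * Real.log n * Real.log n := by ring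
      _ ≤ t * n * Real.log n := by
        gcongr
        exact Real.log_le_self n.cast_nonneg
  calc (n : ℝ) + 2 ≤ 3 * n := by linarith
    _ = 3 * Real.exp (Real.log n) := by rw [Real.exp_log (by positivity)]
    _ ≤ 3 * Real.exp (√((t : ℝ) * n * Real.log n)) := by gcongr
    _ ≤ 3 * 2 ^ (2 * √((t : ℝ) * n * Real.log n)) := by
      gcongr
      exact exp_le_two_rpow (Real.sqrt_nonneg _)

lemma RecTree.add_one_le_of_le_one (hfree : IsPathFree t G) (hd : IsThreshold t n d)
    (hc : RecTree G d (fun _ => 2) c) (hn : n ≤ 1) : (c : ℝ) + 1 ≤ 32 := by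
  have hdn : d ≤ n := hd.le (pos_of_isPathFree hfree)
  have hdepth : min t n * d ≤ 1 :=
    Nat.mul_le_mul ((min_le_right t n).trans hn) (hdn.trans hn)
  have hsize : n.size ≤ d := by
    obtain rfl | hn0 := n.eq_zero_or_pos
    · simp
    · exact (size_le_self n).trans (hn.trans (hd.pos hn0))
  have hgrowth : (1 + (n.size : ℝ) / d) ^ n ≤ 2 ^ 1 := by
    have : (n.size : ℝ) / d ≤ 1 := div_le_one_of_le₀ (by exact_mod_cast hsize) d.cast_nonneg
    calc (1 + (n.size : ℝ) / d) ^ n ≤ (1 + (n.size : ℝ) / d) ^ 1 :=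
          pow_le_pow_right₀ (le_add_of_nonneg_right (by positivity)) hn
      _ ≤ 2 ^ 1 := by linarith
  have hn' : (n : ℝ) ≤ 1 := by exact_mod_cast hn
  calc (c : ℝ) + 1 ≤ 4 * (n + 1) * 2 ^ (min t n * d) * (1 + (n.size : ℝ) / d) ^ n :=
        hc.add_one_le hfree hd
    _ ≤ 4 * (1 + 1) * 2 ^ 1 * 2 ^ 1 := by
        gcongr
        norm_num
    _ = 32 := by norm_num

lemma RecTree.add_one_le_two_rpow (hfree : IsPathFree t G) (hd : IsThreshold t n d)
    (hc : RecTree G d (fun _ => 2) c) :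
    (c : ℝ) + 1 ≤ 32 * 2 ^ (10 * √((t : ℝ) * n * Real.log n)) := by
  obtain hn | hn := n.lt_or_ge 2
  · have hlog : Real.log n = 0 := by interval_cases n <;> simp
    simpa [hlog] using hc.add_one_le_of_le_one hfree hd (by omega)
  set z := √((t : ℝ) * n * Real.log n)
  have hsqrt : √((t : ℝ) * n * n.size) ≤ 2 * z := sqrt_size_le hn t
  have hlow : (2 : ℝ) ^ (min t n * d) ≤ 2 ^ (4 * z) := by
    rw [← Real.rpow_natCast]
    gcongr
    · norm_num
    · linarith [min_mul_threshold_le hd]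
  have hhigh : (1 + (n.size : ℝ) / d) ^ n ≤ 2 ^ (4 * z) := by
    refine (one_add_div_pow_le hd).trans ?_
    exact Real.rpow_le_rpow_of_exponent_le one_le_two (by linarith)
  have hn1 : (n : ℝ) + 1 ≤ 3 * 2 ^ (2 * z) := by linarith [add_two_le (pos_of_isPathFree hfree) n]
  calc (c : ℝ) + 1 ≤ 4 * (n + 1) * 2 ^ (min t n * d) * (1 + (n.size : ℝ) / d) ^ n :=
        hc.add_one_le hfree hd
    _ ≤ 4 * (3 * 2 ^ (2 * z)) * 2 ^ (4 * z) * 2 ^ (4 * z) := by gcongr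
    _ = 12 * 2 ^ (2 * z + 4 * z + 4 * z) := by
      rw [Real.rpow_add two_pos, Real.rpow_add two_pos]
      ring
    _ ≤ 32 * 2 ^ (10 * z) := by
      ring_nf
      gcongr
      norm_num

end Estimates

lemma exists_stepCost_le : ∃ k, ∀ n, setup.cost n + 1 + stepCost n ≤ (n + 2) ^ k := by
  obtain ⟨k, hk⟩ := Code.exists_cost_le
    (setup ;; .skip ;; findActive ;; prepare ;; outputEmpty ;; .skip ;; .skip ;; save ;; combine)
  refine ⟨k, fun n => le_trans (le_of_eq ?_) (hk n)⟩
  simp only [Code.cost, stepCost, overhead]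
  ring

lemma exists_solvesWithin : ∃ C : ℝ, 0 ≤ C ∧ ∀ (t n : ℕ) (G : SimpleGraph (Fin n))
    (w : Fin n → ℝ≥0), IsPathFree t G →
      SolvesWithin program t G w (C * 2 ^ (C * √((t : ℝ) * n * Real.log n))) := by
  obtain ⟨k, hk⟩ := exists_stepCost_le
  refine ⟨3 ^ k * 32 + (2 * k + 10), by positivity, fun t n G w hfree => ?_⟩
  obtain ⟨d, c, T, s, S, hd, hc, hT, hE, hS, hO⟩ := exec_program (pos_of_isPathFree hfree) G w
  refine ⟨T, s, S, hE, ?_, hS, hO⟩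
  set z := √((t : ℝ) * n * Real.log n)
  have hsteps : T ≤ (n + 2) ^ k * (c + 1) := by
    calc T ≤ setup.cost n + 1 + stepCost n * c := hT
      _ ≤ (setup.cost n + 1 + stepCost n) * (c + 1) := by nlinarith
      _ ≤ (n + 2) ^ k * (c + 1) := Nat.mul_le_mul_right _ (hk n)
  calc (T : ℝ) ≤ (n + 2) ^ k * (c + 1) := by exact_mod_cast hsteps
    _ ≤ (3 * 2 ^ (2 * z)) ^ k * (32 * 2 ^ (10 * z)) := by
      gcongr
      · exact add_two_le (pos_of_isPathFree hfree) n
      · exact hc.add_one_le_two_rpow hfree hd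
    _ = 3 ^ k * 32 * 2 ^ ((2 * k + 10) * z) := by
      rw [mul_pow, ← Real.rpow_mul_natCast (zero_le_two (α := ℝ)), add_mul, Real.rpow_add two_pos]
      ring_nf
    _ ≤ (3 ^ k * 32 + (2 * k + 10)) * 2 ^ ((3 ^ k * 32 + (2 * k + 10)) * z) := by
      refine mul_le_mul (le_add_of_nonneg_right (by positivity)) ?_ (by positivity) (by positivity)
      refine Real.rpow_le_rpow_of_exponent_le one_le_two ?_
      exact mul_le_mul_of_nonneg_right (le_add_of_nonneg_left (by positivity)) (Real.sqrt_nonneg _)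

end Time

end PathFreeMWIS

theorem theorem4 :
    (∃ (P : RAM.Program) (C : ℝ), ∀ (t n : ℕ) (G : SimpleGraph (Fin n)) (w : Fin n → ℝ≥0),
      IsPathFree t G →
        SolvesWithin P t G w (C * 2 ^ (C * √((t : ℝ) * n * Real.log n)))) ∧
    (∀ t : ℕ, 5 ≤ t → ∃ (P : RAM.Program) (C : ℝ), ∀ (n : ℕ) (G : SimpleGraph (Fin n)),
      IsPathFree t G →
        SolvesWithin P t G (fun _ => 1) (C * 2 ^ (C * √((n : ℝ) * Real.log n)))) := by
  obtain ⟨C, hC, h⟩ := PathFreeMWIS.exists_solvesWithin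
  refine ⟨⟨_, C, h⟩, fun t ht => ⟨PathFreeMWIS.program, C * √t, fun n G hG => ?_⟩⟩
  obtain ⟨T, s, S, hE, hT, hS⟩ := h t n G (fun _ => 1) hG
  refine ⟨T, s, S, hE, hT.trans ?_, hS⟩
  have ht' : (1 : ℝ) ≤ √t := by
    rw [Real.one_le_sqrt]
    exact_mod_cast (by omega : 1 ≤ t)
  rw [mul_assoc (t : ℝ), Real.sqrt_mul (by positivity), ← mul_assoc C]
  gcongr
  exact le_mul_of_one_le_right hC ht'
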